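/- **Theorem 2 (linear convergence of Pairwise Stochastic Frank–Wolfe).** *Problem.* Let $\mathcal P=\{x\in\mathbb R^p : Cx\le b\}$ be a compact polyhedron with more than one point, $C_i$ the rows of $C$, $V$ its (finite) set of vertices and $D>0$ its Euclidean diameter. Let $n\ge 1$ and let $f_1,\dots,f_n:\mathbb R^p\to\mathbb R$ be differentiable, $f_i$ strongly convex with parameter $\sigma_i>0$ and $\nabla f_i$ Lipschitz continuous with constant $L_i$. Put $F=\frac1n\sum_{i=1}^n f_i$, $F^*=\min_{\mathcal P}F$, $\sigma_F=\min_i\sigma_i$, $L_F=\max_i L_i$. Let $\Omega_{\mathcal P}=\zeta/\theta$, where $\zeta=\min\{b_i-C_iv : v\in V,\ C_iv<b_i\}$ and $\theta=\max\{\|C_i\| : C_iv<b_i\text{ for some }v\in V\}$. *Algorithm.* Start at $x^{(1)}\in V$ with weights $\mu^{(1)}_{x^{(1)}}=1$ and $\mu^{(1)}_v=0$ otherwise. At iteration $k\ge1$ draw $\xi_1,\dots,\xi_{m^{(k)}}$ i.i.d. uniformly from $\{1,\dots,n\}$, independently of all other iterations, and put $F^{(k)}=\frac1{m^{(k)}}\sum_j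 f_{\xi_j}$, $g^{(k)}=\nabla F^{(k)}(x^{(k)})$, $L^{(k)}=\frac1{m^{(k)}}\sum_j L_{\xi_j}$. With $U^{(k)}=\{v\in V:\mu^{(k)}_v>0\}$ choose a vertex $p^{(k)}\in\arg\min_{x\in\mathcal P}\langle g^{(k)},x\rangle$ and $u^{(k)}\in\arg\max_{v\in U^{(k)}}\langle g^{(k)},v\rangle$, and put $d^{(k)}=p^{(k)}-u^{(k)}$ and $\gamma^{(k)}_{\max}=\mu^{(k)}_{u^{(k)}}$. Let $\gamma^{(k)}=\min\{-\langle g^{(k)},d^{(k)}\rangle/(L^{(k)}\|d^{(k)}\|^2),\gamma^{(k)}_{\max}\}$ (read as $0$ if $d^{(k)}=0$), or let $\gamma^{(k)}$ be obtained by exact line search for $\gamma\mapsto F^{(k)}(x^{(k)}+\gamma d^{(k)})$ on $[0,\gamma^{(k)}_{\max}]$. Set $x^{(k+1)}=x^{(k)}+\gamma^{(k)}d^{(k)}$ and move the weight $\gamma^{(k)}$ from $u^{(k)}$ to $p^{(k)}$. There are two variants: either these are the new weights ($N=|V|$), or Carathéodory's theorem is then applied, replacing them by convex weights that represent $x^{(k+1)}$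 by at most $p+1$ of the vertices that are active after the move ($N=p+1$). Ties and reductions may be resolved by any rule for which the $x^{(k)}$ are random variables. *Claim.* For either variant let $$\kappa=\min\Big\{\frac12,\ \frac{\Omega_{\mathcal P}^2\,\sigma_F}{8N^2L_FD^2}\Big\},\qquad m^{(i)}=\big\lceil (1-\kappa)^{-(2i+2)}\big\rceil .$$ Then there are deterministic constants $C_3$ and $0<\phi<\kappa\le\frac12$, depending only on $\mathcal P$ (with $C$, $b$), the $f_i,\sigma_i,L_i$ and the variant, such that for every sequence $(x^{(k)})$ generated by the algorithm and every $k\ge1$ $$\mathbb E\{F(x^{(k+1)})-F^*\}\le C_3\,(1-\phi)^{k/(3\,|V|!+1)} .$$ -/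

import Mathlib

namespace PSFW

/-- `ℝᵖ` with its Euclidean norm. -/
abbrev E (p : ℕ) : Type := EuclideanSpace ℝ (Fin p)

/-! ### The polytope and its constants -/

/-- The polyhedron `{x : C x ≤ b}`; `C i` is the `i`-th row of the constraint matrix. -/
def polytope {p m : ℕ} (C : Fin m → E p) (b : Fin m → ℝ) : Set (E p) :=
  {x | ∀ i, inner ℝ (C i) x ≤ b i}

/-- The set of vertices (extreme points) of the polyhedron. -/
def vertices {p m : ℕ} (C : Fin m → E p) (b : Fin m → ℝ) : Set (E p) :=
  (polytope C b).extremePoints ℝ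

/-- The smallest positive slack `b i - C i v` over all vertices `v` and all constraints `i`. -/
noncomputable def minSlack {p m : ℕ} (C : Fin m → E p) (b : Fin m → ℝ) : ℝ :=
  sInf {s | ∃ v ∈ vertices C b, ∃ i, inner ℝ (C i) v < b i ∧ s = b i - inner ℝ (C i) v}

/-- The indices of the constraints that are active at every vertex. -/
def activeAtAll {p m : ℕ} (C : Fin m → E p) (b : Fin m → ℝ) : Set (Fin m) :=
  {i | ∀ v ∈ vertices C b, inner ℝ (C i) v = b i}

/-- The largest norm of a row whose constraint is not active at every vertex. -/
noncomputable def maxRowNorm {p m : ℕ} (C : Fin m → E p) (b : Fin m → ℝ) : ℝ :=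
  sSup ((fun i => ‖C i‖) '' (activeAtAll C b)ᶜ)

/-- The constant `Ω_P`. -/
noncomputable def polytopeConst {p m : ℕ} (C : Fin m → E p) (b : Fin m → ℝ) : ℝ :=
  minSlack C b / maxRowNorm C b

/-- The bound `N` on the number of vertices used to represent an iterate: `p + 1` if the vertex
representation is reduced by Carathéodory's theorem, and the number of all vertices otherwise. -/
noncomputable def numVertices {p m : ℕ} (C : Fin m → E p) (b : Fin m → ℝ) (carath : Bool) : ℕ :=
  if carath then p + 1 else (vertices C b).ncard

/-- `κ = min {1/2, Ω_P² σ_F / (8 N² L_F D²)}` with `σ_F = min σ_i`, `L_F = max L_i` and `D` the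
diameter of the polytope. -/
noncomputable def kappa {n p m : ℕ} (C : Fin m → E p) (b : Fin m → ℝ)
    (σ : Fin n → ℝ) (L : Fin n → NNReal) (carath : Bool) : ℝ :=
  min (1 / 2) (polytopeConst C b ^ 2 * (⨅ i, σ i) /
    (8 * (numVertices C b carath : ℝ) ^ 2 * (⨆ i, (L i : ℝ)) * Metric.diam (polytope C b) ^ 2))

/-- The batch size `⌈1 / (1 - κ)^(2 i + 2)⌉` of iteration `i`. -/
noncomputable def batchSize (κ : ℝ) (i : ℕ) : ℕ :=
  ⌈1 / (1 - κ) ^ (2 * i + 2)⌉₊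

/-! ### The objective and its sampled versions -/

/-- The objective `F = (1/n) ∑ f_i`. -/
noncomputable def objective {n p : ℕ} (f : Fin n → E p → ℝ) (x : E p) : ℝ :=
  (1 / (n : ℝ)) * ∑ i, f i x

/-- The optimal value of `min_{x ∈ P} F x`. -/
noncomputable def optValue {n p m : ℕ} (f : Fin n → E p → ℝ) (C : Fin m → E p)
    (b : Fin m → ℝ) : ℝ :=
  sInf (objective f '' polytope C b)

/-- The sampled objective `(1/M) ∑_j f_{s j}` of a batch `s` of size `M`. -/
noncomputable def batchObjective {n p M : ℕ} (f : Fin n → E p → ℝ) (s : Fin M → Fin n)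
    (x : E p) : ℝ :=
  (1 / (M : ℝ)) * ∑ j, f (s j) x

/-- The stochastic gradient `(1/M) ∑_j ∇ f_{s j} (x)` of a batch `s` of size `M`. -/
noncomputable def batchGradient {n p M : ℕ} (f : Fin n → E p → ℝ) (s : Fin M → Fin n)
    (x : E p) : E p :=
  (1 / (M : ℝ)) • ∑ j, gradient (f (s j)) x

/-- The sampled Lipschitz constant `(1/M) ∑_j L_{s j}` of a batch `s` of size `M`. -/
noncomputable def batchLipschitz {n M : ℕ} (L : Fin n → NNReal) (s : Fin M → Fin n) : ℝ :=
  (1 / (M : ℝ)) * ∑ j, (L (s j) : ℝ)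

/-! ### The algorithm

A vertex representation of an iterate is a finitely supported weight function `μ` on `ℝᵖ`; the set
of active vertices is `μ.support`. -/

/-- The step size: either the short step `min {-⟨g, d⟩ / (L ‖d‖²), γmax}`, or an exact line search
on `[0, γmax]` for the sampled objective `Fs`. -/
def IsStepSize {p : ℕ} (Fs : E p → ℝ) (Ls : ℝ) (g x d : E p) (γmax γ : ℝ) : Prop :=
  γ = min (-(inner ℝ g d) / (Ls * ‖d‖ ^ 2)) γmax ∨
    (γ ∈ Set.Icc 0 γmax ∧ IsMinOn (fun t : ℝ => Fs (x + t • d)) (Set.Icc 0 γmax) γ)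

/-- `ν` is a Carathéodory reduction of the vertex representation `μ` of `y`: it represents `y` as a
convex combination of at most `p + 1` of the active vertices of `μ`. -/
structure IsCaratheodoryReduction {p : ℕ} (y : E p) (μ ν : E p →₀ ℝ) : Prop where
  support_subset : ν.support ⊆ μ.support
  card_le : ν.support.card ≤ p + 1
  nonneg : ∀ v, 0 ≤ ν v
  sum_eq_one : (ν.sum fun _ a => a) = 1
  sum_eq : (ν.sum fun v a => a • v) = y

/-- One iteration of the algorithm with batch `s`, from the iterate `x` with vertex representation
`μ` to the iterate `x'` with vertex representation `μ'`. The weight `γ` is moved from the active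
vertex `u` to the vertex `v`; if `carath` is set, Carathéodory's theorem is applied afterwards. -/
def IsStep {n p m M : ℕ} (C : Fin m → E p) (b : Fin m → ℝ) (f : Fin n → E p → ℝ)
    (L : Fin n → NNReal) (carath : Bool) (s : Fin M → Fin n)
    (x : E p) (μ : E p →₀ ℝ) (x' : E p) (μ' : E p →₀ ℝ) : Prop :=
  ∃ (v u : E p) (γ : ℝ),
    (v ∈ vertices C b ∧
      IsMinOn (fun y => inner ℝ (batchGradient f s x) y) (polytope C b) v) ∧
    (u ∈ μ.support ∧
      ∀ w ∈ μ.support, inner ℝ (batchGradient f s x) w ≤ inner ℝ (batchGradient f s x) u) ∧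
    IsStepSize (batchObjective f s) (batchLipschitz L s) (batchGradient f s x) x (v - u) (μ u) γ ∧
    x' = x + γ • (v - u) ∧
    (if carath then
      IsCaratheodoryReduction x' (μ + Finsupp.single v γ - Finsupp.single u γ) μ'
    else μ' = μ + Finsupp.single v γ - Finsupp.single u γ)

/-- `x 1, x 2, …` is generated by the Pairwise Stochastic Frank-Wolfe algorithm from the batches
`s 1, s 2, …`, and `μ k` is the vertex representation of `x k` kept by the algorithm
(index `0` is not used). -/
structure IsRun {n p m : ℕ} (C : Fin m → E p) (b : Fin m → ℝ) (f : Fin n → E p → ℝ)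
    (L : Fin n → NNReal) (carath : Bool) {M : ℕ → ℕ} (s : (k : ℕ) → Fin (M k) → Fin n)
    (x : ℕ → E p) (μ : ℕ → E p →₀ ℝ) : Prop where
  start_mem : x 1 ∈ vertices C b
  start_rep : μ 1 = Finsupp.single (x 1) 1
  step : ∀ k, 1 ≤ k → IsStep C b f L carath (s k) (x k) (μ k) (x (k + 1)) (μ (k + 1))

/-- The samples `ξ k j`, `k ≥ 1`, `j < M k`, are independent and uniform on the `n` indices. -/
structure IsIIDUniform {n : ℕ} {M : ℕ → ℕ} {Ω : Type*} [MeasurableSpace Ω]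
    (P : MeasureTheory.Measure Ω) (ξ : (k : ℕ) → Fin (M k) → Ω → Fin n) : Prop where
  measurable : ∀ k, 1 ≤ k → ∀ j, Measurable (ξ k j)
  uniform : ∀ k, 1 ≤ k → ∀ j i, P {ω | ξ k j ω = i} = (n : ENNReal)⁻¹
  indep : ProbabilityTheory.iIndepFun
    (fun q : (Σ k : ℕ, Fin (M (k + 1))) => ξ (q.1 + 1) q.2) P

end PSFW

namespace PSFW

/-! Each iteration decreases the sampled objective by at least a multiple of the squared step
length. In addition, either the decrease is at least a multiple of the squared pairwise gap ⟨g, u -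
v⟩, or the iteration is a drop step that removes u from the active set (`IsStep.progress`). A
Hoffman-type bound (`exists_lipschitz_weights`, `exists_pairwise_gap_bound`) together with strong
convexity controls the optimality gap by the squared pairwise gap, up to sampling error.

Suppose the optimality gap failed to shrink by a fixed factor over |V| + 1 iterations. Then all
steps in the block are short and the gradient is almost constant. Every iteration is a drop step
that discards a vertex with a high linear value and can add only one with a low value, so the high
vertices run out before the block ends. Hence a block contracts the gap up to the squared sampling
errors (`exists_block_contraction`). Carathéodory reductions do no harm, since they only shrink the
active set.

Sampling enters only through the ℓ¹-distance of the batch frequencies from the uniform distribution.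
This distance bounds the gradient error uniformly on the polytope, so the contraction holds path by
path (`exists_run_contraction`) and taking expectations needs no conditioning on the past. Its mean
square is at most n² divided by the batch size, hence decays like (1 - κ)^(2k), and
`exists_geometric_rate` yields a bound B ρ^k with ρ < 1. Since k / (3 |V|! + 1) ≤ k, the claimed
rate follows for any φ ≤ 1 - ρ. -/

/-- `Q` is strongly convex with parameter `σ`, and its gradient field `G` is Lipschitz continuous
with constant `ℓ`; the two quadratic bounds are recorded in first-order form. -/
structure IsSmoothStronglyConvex {F : Type*} [NormedAddCommGroup F] [InnerProductSpace ℝ F]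
    (Q : F → ℝ) (G : F → F) (σ ℓ : ℝ) : Prop where
  lower : ∀ x y, Q x + inner ℝ (G x) (y - x) + σ / 2 * ‖y - x‖ ^ 2 ≤ Q y
  upper : ∀ x y, Q y ≤ Q x + inner ℝ (G x) (y - x) + ℓ / 2 * ‖y - x‖ ^ 2
  lip : ∀ x y, ‖G y - G x‖ ≤ ℓ * ‖y - x‖

/-! ### First-order forms of strong convexity and smoothness -/

section Calculus

variable {F : Type*} [NormedAddCommGroup F] [InnerProductSpace ℝ F] [CompleteSpace F]

theorem hasDerivAt_comp_line {f : F → ℝ} (hf : Differentiable ℝ f) (x d : F) (t : ℝ) :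
    HasDerivAt (fun s : ℝ => f (x + s • d)) (inner ℝ (gradient f (x + t • d)) d) t := by
  have h1 : HasDerivAt (fun s : ℝ => x + s • d) d t := by
    simpa using ((hasDerivAt_id t).smul_const d).const_add x
  have h2 := (hf (x + t • d)).hasGradientAt.hasFDerivAt
  have h3 := h2.comp_hasDerivAt t h1
  exact h3.congr_deriv (by simp)

/-- Divide the convexity inequality on the segment from x to y by the weight t of y and let t tend
to 0 from the right. -/
theorem StrongConvexOn.gradient_le {f : F → ℝ} {σ : ℝ} (hc : StrongConvexOn Set.univ σ f)
    (hf : Differentiable ℝ f) (x y : F) :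
    f x + inner ℝ (gradient f x) (y - x) + σ / 2 * ‖y - x‖ ^ 2 ≤ f y := by
  have hd := hasDerivAt_comp_line hf x (y - x) 0
  rw [zero_smul, add_zero] at hd
  have h1 := hd.tendsto_slope_zero_right
  have h2 : Filter.Tendsto (fun t : ℝ => f y - f x - (1 - t) * (σ / 2 * ‖y - x‖ ^ 2))
      (nhdsWithin 0 (Set.Ioi 0)) (nhds (f y - f x - (1 - 0) * (σ / 2 * ‖y - x‖ ^ 2))) := by
    apply Filter.Tendsto.mono_left _ nhdsWithin_le_nhds
    exact Continuous.tendsto (by fun_prop) 0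
  have h3 := le_of_tendsto_of_tendsto h1 h2 ?_
  · linarith
  filter_upwards [Ioo_mem_nhdsGT (show (0 : ℝ) < 1 by norm_num)] with t ht
  have h4 := hc.2 (Set.mem_univ x) (Set.mem_univ y) (sub_nonneg.2 ht.2.le) ht.1.le (by ring)
  have h5 : (1 - t) • x + t • y = x + t • (y - x) := by module
  rw [h5] at h4
  simp only [smul_eq_mul, zero_add, zero_smul, add_zero] at h4 ⊢
  rw [inv_mul_le_iff₀ ht.1, norm_sub_rev y x]
  nlinarith

/-- Restricted to the segment, f minus its quadratic upper model has nonpositive derivative, by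
Cauchy–Schwarz and the Lipschitz bound; this avoids integrating the gradient. -/
theorem le_add_of_lipschitzWith_gradient {f : F → ℝ} {L : NNReal} (hf : Differentiable ℝ f)
    (hL : LipschitzWith L (gradient f)) (x y : F) :
    f y ≤ f x + inner ℝ (gradient f x) (y - x) + L / 2 * ‖y - x‖ ^ 2 := by
  set d := y - x with hd
  have hder : ∀ t : ℝ, HasDerivAt
      (fun s : ℝ => f (x + s • d) - s * inner ℝ (gradient f x) d - L / 2 * ‖d‖ ^ 2 * s ^ 2)
      (inner ℝ (gradient f (x + t • d)) d - inner ℝ (gradient f x) d - L * ‖d‖ ^ 2 * t) t := by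
    intro t
    have h1 := hasDerivAt_comp_line hf x d t
    have h2 := (hasDerivAt_id t).mul_const (inner ℝ (gradient f x) d)
    have h3 := ((hasDerivAt_id t).pow 2).const_mul ((L : ℝ) / 2 * ‖d‖ ^ 2)
    refine ((h1.sub h2).sub h3).congr_deriv ?_
    simp only [id, one_mul, Nat.cast_ofNat, Nat.add_one_sub_one, pow_one, mul_one]
    ring
  have hanti : AntitoneOn
      (fun s : ℝ => f (x + s • d) - s * inner ℝ (gradient f x) d - L / 2 * ‖d‖ ^ 2 * s ^ 2)
      (Set.Icc 0 1) := by
    apply antitoneOn_of_deriv_nonpos (convex_Icc 0 1)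
    · exact fun t _ => (hder t).continuousAt.continuousWithinAt
    · exact fun t _ => (hder t).differentiableAt.differentiableWithinAt
    · intro t ht
      rw [interior_Icc] at ht
      rw [(hder t).deriv, ← inner_sub_left]
      have h1 := real_inner_le_norm (gradient f (x + t • d) - gradient f x) d
      have h2 := hL.dist_le_mul (x + t • d) x
      rw [dist_eq_norm, dist_eq_norm, add_sub_cancel_left, norm_smul, Real.norm_of_nonneg ht.1.le]
        at h2
      nlinarith [norm_nonneg d]
  have h := hanti (Set.left_mem_Icc.2 zero_le_one) (Set.right_mem_Icc.2 zero_le_one) zero_le_one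
  simp only [one_smul, zero_smul, add_zero] at h
  rw [hd, add_sub_cancel] at h
  rw [← hd] at h
  linarith

theorem isSmoothStronglyConvex_gradient {f : F → ℝ} {σ : ℝ} {L : NNReal}
    (hc : StrongConvexOn Set.univ σ f) (hf : Differentiable ℝ f)
    (hL : LipschitzWith L (gradient f)) : IsSmoothStronglyConvex f (gradient f) σ L where
  lower := StrongConvexOn.gradient_le hc hf
  upper := le_add_of_lipschitzWith_gradient hf hL
  lip x y := by simpa [dist_eq_norm] using hL.dist_le_mul y x

end Calculus

/-! ### Smooth strongly convex functions: averages and elementary estimates -/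

namespace IsSmoothStronglyConvex

variable {F : Type*} [NormedAddCommGroup F] [InnerProductSpace ℝ F] {Q : F → ℝ} {G : F → F}
  {σ ℓ : ℝ}

theorem le_lipschitz [Nontrivial F] (h : IsSmoothStronglyConvex Q G σ ℓ) : σ ≤ ℓ := by
  obtain ⟨x, y, hxy⟩ := exists_pair_ne F
  have h1 := h.lower x y
  have h2 := h.upper x y
  have h3 : 0 < ‖y - x‖ ^ 2 := by
    have := norm_pos_iff.2 (sub_ne_zero.2 hxy.symm)
    positivity
  nlinarith

theorem mono {σ' ℓ' : ℝ} (h : IsSmoothStronglyConvex Q G σ ℓ) (hσ : σ' ≤ σ) (hℓ : ℓ ≤ ℓ') :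
    IsSmoothStronglyConvex Q G σ' ℓ' where
  lower x y := by nlinarith [h.lower x y, sq_nonneg ‖y - x‖]
  upper x y := by nlinarith [h.upper x y, sq_nonneg ‖y - x‖]
  lip x y := by nlinarith [h.lip x y, norm_nonneg (y - x)]

/-- A convex combination of smooth strongly convex functions. -/
theorem weighted_sum {ι : Type*} [Fintype ι] {f : ι → F → ℝ} {g : ι → F → F} {L : ι → ℝ}
    {w : ι → ℝ} (hw : ∀ i, 0 ≤ w i) (hw1 : ∑ i, w i = 1)
    (h : ∀ i, IsSmoothStronglyConvex (f i) (g i) σ (L i)) :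
    IsSmoothStronglyConvex (fun x => ∑ i, w i * f i x) (fun x => ∑ i, w i • g i x) σ
      (∑ i, w i * L i) where
  lower x y := by
    have h1 : ∑ i, w i * (f i x + inner ℝ (g i x) (y - x) + σ / 2 * ‖y - x‖ ^ 2) ≤
        ∑ i, w i * f i y :=
      Finset.sum_le_sum fun i _ => mul_le_mul_of_nonneg_left ((h i).lower x y) (hw i)
    simp only [mul_add, Finset.sum_add_distrib, ← Finset.sum_mul, hw1, one_mul] at h1
    simpa only [sum_inner, real_inner_smul_left] using h1
  upper x y := by
    have h1 : ∑ i, w i * f i y ≤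
        ∑ i, w i * (f i x + inner ℝ (g i x) (y - x) + L i / 2 * ‖y - x‖ ^ 2) :=
      Finset.sum_le_sum fun i _ => mul_le_mul_of_nonneg_left ((h i).upper x y) (hw i)
    simp only [mul_add, Finset.sum_add_distrib] at h1
    have h2 : ∑ i, w i * (L i / 2 * ‖y - x‖ ^ 2) = (∑ i, w i * L i) / 2 * ‖y - x‖ ^ 2 := by
      rw [Finset.sum_div, Finset.sum_mul]
      exact Finset.sum_congr rfl fun i _ => by ring
    rw [h2] at h1
    simpa only [sum_inner, real_inner_smul_left] using h1
  lip x y := by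
    rw [← Finset.sum_sub_distrib, Finset.sum_mul]
    refine (norm_sum_le _ _).trans (Finset.sum_le_sum fun i _ => ?_)
    rw [← smul_sub, norm_smul, Real.norm_of_nonneg (hw i), mul_assoc]
    exact mul_le_mul_of_nonneg_left ((h i).lip x y) (hw i)

/-- By convexity, the gradient at one end point bounds the decrease towards the other, so bounds at
the two end points suffice. -/
theorem abs_sub_le (hσ : 0 ≤ σ) (h : IsSmoothStronglyConvex Q G σ ℓ) {B : ℝ} {x y : F}
    (hx : ‖G x‖ ≤ B) (hy : ‖G y‖ ≤ B) : |Q x - Q y| ≤ B * ‖x - y‖ := by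
  have key : ∀ a b : F, ‖G a‖ ≤ B → Q a - Q b ≤ B * ‖a - b‖ := by
    intro a b ha
    have h1 := h.lower a b
    have h2 := neg_le_of_abs_le (abs_real_inner_le_norm (G a) (b - a))
    have h3 : ‖G a‖ * ‖b - a‖ ≤ B * ‖b - a‖ := mul_le_mul_of_nonneg_right ha (norm_nonneg _)
    have h4 : 0 ≤ σ / 2 * ‖b - a‖ ^ 2 := by positivity
    rw [norm_sub_rev a b]
    linarith
  rw [abs_le]
  constructor
  · have := key y x hy
    rw [norm_sub_rev y x] at this
    linarith
  · exact key x y hx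

/-- A minimizer on a segment improves the value at an end point quadratically. -/
theorem sub_ge_of_midpoint_ge (h : IsSmoothStronglyConvex Q G σ ℓ) {x y : F}
    (hm : Q y ≤ Q ((1 / 2 : ℝ) • (x + y))) : σ / 4 * ‖y - x‖ ^ 2 ≤ Q x - Q y := by
  set z := (1 / 2 : ℝ) • (x + y) with hz
  have h1 := h.lower z x
  have h2 := h.lower z y
  have e1 : x - z = -((1 / 2 : ℝ) • (y - x)) := by rw [hz]; module
  have e2 : y - z = (1 / 2 : ℝ) • (y - x) := by rw [hz]; module
  rw [e1, inner_neg_right, norm_neg, norm_smul] at h1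
  rw [e2, norm_smul] at h2
  norm_num at h1 h2
  nlinarith

end IsSmoothStronglyConvex

/-! ### Vertices and constants of the polytope -/

section Polytope

variable {p m : ℕ} {C : Fin m → E p} {b : Fin m → ℝ}

theorem convex_polytope (C : Fin m → E p) (b : Fin m → ℝ) : Convex ℝ (polytope C b) := by
  intro x hx y hy s t hs ht hst i
  rw [inner_add_right, real_inner_smul_right, real_inner_smul_right]
  calc s * inner ℝ (C i) x + t * inner ℝ (C i) y ≤ s * b i + t * b i := by
        gcongr
        · exact hx i
        · exact hy i
    _ = b i := by rw [← add_mul, hst, one_mul]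

/-- A vertex is determined by its set of active constraints, and there are finitely many such sets.
-/
theorem finite_vertices (C : Fin m → E p) (b : Fin m → ℝ) : (vertices C b).Finite := by
  refine Set.Finite.of_injOn (f := fun v => {i | inner ℝ (C i) v = b i})
    (Set.mapsTo_univ _ _) ?_ Set.finite_univ
  intro v hv w hw hvw
  have hiff : ∀ i, inner ℝ (C i) v = b i ↔ inner ℝ (C i) w = b i := fun i => by
    simpa using Set.ext_iff.1 hvw i
  -- Moving v slightly away from w keeps it feasible: active constraints are common to both points,
  -- and inactive ones have slack. Then v lies strictly between a feasible point and w.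
  have hev : ∀ᶠ ε : ℝ in nhdsWithin 0 (Set.Ioi 0), ∀ i,
      inner ℝ (C i) (v - ε • (w - v)) ≤ b i := by
    rw [Filter.eventually_all]
    intro i
    rcases (hv.1 i).eq_or_lt with h | h
    · refine Filter.Eventually.of_forall fun ε => ?_
      rw [inner_sub_right, real_inner_smul_right, inner_sub_right, h, (hiff i).1 h]
      simp
    · apply Filter.Eventually.filter_mono nhdsWithin_le_nhds
      have hc : Continuous fun ε : ℝ => inner ℝ (C i) (v - ε • (w - v)) := by fun_prop
      have := hc.tendsto 0
      simp only [zero_smul, sub_zero] at this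
      exact (this.eventually (gt_mem_nhds h)).mono fun ε hε => le_of_lt hε
  obtain ⟨ε, hε, hε0⟩ := (hev.and self_mem_nhdsWithin).exists
  have hε0 : 0 < ε := hε0
  have hseg : v ∈ openSegment ℝ (v - ε • (w - v)) w := by
    refine ⟨1 / (1 + ε), ε / (1 + ε), by positivity, by positivity, by field_simp, ?_⟩
    rw [← sub_eq_zero]
    have : (1 / (1 + ε)) • (v - ε • (w - v)) + (ε / (1 + ε)) • w - v =
        ((1 + ε) / (1 + ε) - 1) • v := by module
    rw [this, div_self (by positivity), sub_self, zero_smul]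
  exact ((mem_extremePoints.1 hv).2 _ hε _ hw.1 hseg).2.symm

theorem convexHull_vertices (hc : IsCompact (polytope C b)) :
    convexHull ℝ (vertices C b) = polytope C b := by
  rw [← closure_convexHull_extremePoints hc (convex_polytope C b)]
  exact (((finite_vertices C b).isCompact_convexHull ℝ).isClosed.closure_eq).symm

theorem vertices_nontrivial (hc : IsCompact (polytope C b)) (hn : (polytope C b).Nontrivial) :
    (vertices C b).Nontrivial := by
  by_contra h
  rw [Set.not_nontrivial_iff] at h
  rw [← convexHull_vertices hc] at hn
  rcases h.eq_empty_or_singleton with h | ⟨x, h⟩ <;> simp [h] at hn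

/-- Two distinct points of a bounded polyhedron are separated by one of its rows. -/
theorem exists_row_ne (hc : IsCompact (polytope C b)) {v w : E p} (hv : v ∈ polytope C b)
    (hvw : v ≠ w) : ∃ i, inner ℝ (C i) v ≠ inner ℝ (C i) w := by
  by_contra! h
  have hd : 0 < ‖w - v‖ := norm_pos_iff.2 (sub_ne_zero.2 hvw.symm)
  -- If no row separates v from w, the whole line through them is feasible, which contradicts the
  -- finite diameter.
  have hmem : ∀ t : ℝ, v + t • (w - v) ∈ polytope C b := by
    intro t i
    rw [inner_add_right, real_inner_smul_right, inner_sub_right, h i, sub_self, mul_zero, add_zero,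
      ← h i]
    exact hv i
  have h1 := Metric.dist_le_diam_of_mem hc.isBounded
    (hmem ((Metric.diam (polytope C b) + 1) / ‖w - v‖)) hv
  rw [dist_eq_norm, add_sub_cancel_left, norm_smul, Real.norm_of_nonneg
    (by have := Metric.diam_nonneg (s := polytope C b); positivity),
    div_mul_cancel₀ _ hd.ne'] at h1
  linarith

/-- This serves only to make κ positive; the contraction factor itself comes from a compactness
argument and does not involve Ω_P. -/
theorem polytopeConst_pos (hc : IsCompact (polytope C b)) (hn : (polytope C b).Nontrivial) :
    0 < polytopeConst C b := by
  obtain ⟨v, hv, w, hw, hvw⟩ := vertices_nontrivial hc hn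
  obtain ⟨i, hi⟩ := exists_row_ne hc hv.1 hvw
  have hslack : ∃ u ∈ vertices C b, inner ℝ (C i) u < b i := by
    by_contra! h
    exact hi (((hv.1 i).antisymm (h v hv)).trans ((hw.1 i).antisymm (h w hw)).symm)
  obtain ⟨u, hu, hui⟩ := hslack
  apply div_pos
  · have hfin : {s | ∃ v ∈ vertices C b, ∃ i, inner ℝ (C i) v < b i ∧
        s = b i - inner ℝ (C i) v}.Finite := by
      refine (((finite_vertices C b).prod (Set.finite_univ (α := Fin m))).image
        fun q => b q.2 - inner ℝ (C q.2) q.1).subset ?_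
      rintro s ⟨v, hv, i, -, rfl⟩
      exact ⟨(v, i), ⟨hv, Set.mem_univ _⟩, rfl⟩
    obtain ⟨v, -, i, h, h2⟩ := Set.Nonempty.csInf_mem (s := {s | ∃ v ∈ vertices C b, ∃ i,
      inner ℝ (C i) v < b i ∧ s = b i - inner ℝ (C i) v}) ⟨_, u, hu, i, hui, rfl⟩ hfin
    rw [minSlack, h2]
    linarith
  · have hi0 : C i ≠ 0 := by
      intro h
      simp [h] at hi
    refine (norm_pos_iff.2 hi0).trans_le (le_csSup ((Set.toFinite _).image _).bddAbove ?_)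
    exact ⟨i, fun h => hui.ne (h u hu), rfl⟩

theorem numVertices_pos (hc : IsCompact (polytope C b)) (hn : (polytope C b).Nontrivial)
    (carath : Bool) : 0 < numVertices C b carath := by
  unfold numVertices
  split
  · exact Nat.succ_pos p
  · exact (Set.ncard_pos (finite_vertices C b)).2 (vertices_nontrivial hc hn).nonempty

theorem diam_polytope_pos (hc : IsCompact (polytope C b)) (hn : (polytope C b).Nontrivial) :
    0 < Metric.diam (polytope C b) := Metric.diam_pos hn hc.isBounded

theorem kappa_pos {n : ℕ} (hN : 0 < n) (hc : IsCompact (polytope C b))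
    (hn : (polytope C b).Nontrivial) {σ : Fin n → ℝ} {L : Fin n → NNReal} (hσ : ∀ i, 0 < σ i)
    (hL : ∀ i, 0 < L i) (carath : Bool) : 0 < kappa C b σ L carath := by
  have : Nonempty (Fin n) := ⟨⟨0, hN⟩⟩
  have h1 := polytopeConst_pos hc hn
  have h2 : (0 : ℝ) < numVertices C b carath := by exact_mod_cast numVertices_pos hc hn carath
  have h3 := diam_polytope_pos hc hn
  have h4 : 0 < ⨆ i, (L i : ℝ) := by
    refine lt_of_lt_of_le ?_ (le_ciSup (Set.finite_range _).bddAbove (⟨0, hN⟩ : Fin n))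
    exact_mod_cast hL _
  have h5 : 0 < ⨅ i, σ i := by
    obtain ⟨i, hi⟩ := exists_eq_ciInf_of_finite (f := σ)
    rw [← hi]
    exact hσ i
  unfold kappa
  positivity

theorem kappa_le_half {n : ℕ} (C : Fin m → E p) (b : Fin m → ℝ) (σ : Fin n → ℝ)
    (L : Fin n → NNReal) (carath : Bool) : kappa C b σ L carath ≤ 1 / 2 := min_le_left _ _

end Polytope

/-! ### A Hoffman-type bound for convex weights -/

section Hoffman

variable {ι F : Type*} [Fintype ι] [NormedAddCommGroup F] [NormedSpace ℝ F]

/-- A uniform lower bound for a linear map on sign-constrained vectors, as long as the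
corresponding closed orthant face meets the kernel trivially. -/
theorem exists_norm_le_of_sign (A : (ι → ℝ) →ₗ[ℝ] F) (s : ι → SignType)
    (hs : ∀ w : ι → ℝ, (∀ i, SignType.sign (w i) = s i ∨ w i = 0) → A w = 0 → w = 0) :
    ∃ K : ℝ, ∀ w : ι → ℝ, (∀ i, SignType.sign (w i) = s i) → ‖w‖ ≤ K * ‖A w‖ := by
  -- Allowing zero coordinates closes the orthant face, so ‖A w‖ attains a minimum on its unit
  -- sphere, positive by `hs`.
  set S : Set (ι → ℝ) := {w | ∀ i, SignType.sign (w i) = s i ∨ w i = 0} with hS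
  have hclosed : IsClosed S := by
    rw [hS, Set.ofPred_forall]
    refine isClosed_iInter fun i => ?_
    have hi : IsClosed {x : ℝ | SignType.sign x = s i ∨ x = 0} := by
      rcases h : s i with _ | _ | _
      · have : {x : ℝ | SignType.sign x = SignType.zero ∨ x = 0} = {0} := by
          ext x
          change SignType.sign x = 0 ∨ x = 0 ↔ x = 0
          simp [sign_eq_zero_iff]
        rw [this]
        exact isClosed_singleton
      · have : {x : ℝ | SignType.sign x = SignType.neg ∨ x = 0} = Set.Iic 0 := by
          ext x
          change SignType.sign x = -1 ∨ x = 0 ↔ x ≤ 0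
          rw [sign_eq_neg_one_iff, le_iff_lt_or_eq]
        rw [this]
        exact isClosed_Iic
      · have : {x : ℝ | SignType.sign x = SignType.pos ∨ x = 0} = Set.Ici 0 := by
          ext x
          change SignType.sign x = 1 ∨ x = 0 ↔ 0 ≤ x
          rw [sign_eq_one_iff, le_iff_lt_or_eq, eq_comm (a := x)]
        rw [this]
        exact isClosed_Ici
    exact hi.preimage (f := fun w : ι → ℝ => w i) (continuous_apply i)
  have hcont : Continuous A := A.continuous_of_finiteDimensional
  have hcomp : IsCompact (S ∩ Metric.sphere 0 1) := (isCompact_sphere 0 1).inter_left hclosed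
  have hscale : ∀ w : ι → ℝ, (∀ i, SignType.sign (w i) = s i) → w ≠ 0 →
      (‖w‖⁻¹ • w) ∈ S ∩ Metric.sphere 0 1 := by
    intro w hw h0
    have hp : 0 < ‖w‖ := norm_pos_iff.2 h0
    refine ⟨fun i => Or.inl ?_, by simp [norm_smul, hp.ne']⟩
    rw [← hw i, Pi.smul_apply, smul_eq_mul, sign_mul, sign_pos (inv_pos.2 hp), one_mul]
  rcases (S ∩ Metric.sphere 0 1).eq_empty_or_nonempty with he | hne
  · refine ⟨0, fun w hw => ?_⟩
    by_cases h0 : w = 0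
    · simp [h0]
    · have := hscale w hw h0
      rw [he] at this
      exact this.elim
  · obtain ⟨w₀, hw₀, hmin⟩ := hcomp.exists_isMinOn hne hcont.norm.continuousOn
    have hpos : 0 < ‖A w₀‖ := by
      rw [norm_pos_iff]
      intro h
      have h1 := hw₀.2
      rw [hs w₀ hw₀.1 h] at h1
      simp at h1
    refine ⟨‖A w₀‖⁻¹, fun w hw => ?_⟩
    by_cases h0 : w = 0
    · simp [h0]
    · have h1 : ‖A w₀‖ ≤ ‖A (‖w‖⁻¹ • w)‖ := hmin (hscale w hw h0)
      have hp : 0 < ‖w‖ := norm_pos_iff.2 h0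
      rw [map_smul, norm_smul, norm_inv, norm_norm, le_inv_mul_iff₀ hp] at h1
      rw [le_inv_mul_iff₀ hpos]
      linarith

/-- Convex representations depend in a Lipschitz way on the represented point: any convex weights
`μ` are close to suitable convex weights of a second point `∑ i, lam i • a i`. -/
theorem exists_lipschitz_weights (a : ι → F) :
    ∃ K : ℝ, 0 ≤ K ∧ ∀ μ ∈ stdSimplex ℝ ι, ∀ lam ∈ stdSimplex ℝ ι, ∃ ν ∈ stdSimplex ℝ ι,
      ∑ i, ν i • a i = ∑ i, lam i • a i ∧
      ∑ i, |ν i - μ i| ≤ K * ‖∑ i, lam i • a i - ∑ i, μ i • a i‖ := by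
  classical
  let A₁ : (ι → ℝ) →ₗ[ℝ] F := Fintype.linearCombination ℝ a
  let A₂ : (ι → ℝ) →ₗ[ℝ] ℝ := Fintype.linearCombination ℝ fun _ => (1 : ℝ)
  let A := A₁.prod A₂
  have hA₁ : ∀ w, A₁ w = ∑ i, w i • a i := fun w => Fintype.linearCombination_apply ..
  have hA₂ : ∀ w, A₂ w = ∑ i, w i := fun w => by
    simp [A₂, Fintype.linearCombination_apply]
  -- The constants are fixed per sign pattern, before the weights are known. Finitely many patterns
  -- exist, so their sum is uniform; patterns that violate the kernel condition get the default 0.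
  have hK : ∀ s : ι → SignType, ∃ K : ℝ,
      (∀ w : ι → ℝ, (∀ i, SignType.sign (w i) = s i ∨ w i = 0) → A w = 0 → w = 0) →
      ∀ w : ι → ℝ, (∀ i, SignType.sign (w i) = s i) → ‖w‖ ≤ K * ‖A w‖ := by
    intro s
    by_cases hs : ∀ w : ι → ℝ, (∀ i, SignType.sign (w i) = s i ∨ w i = 0) → A w = 0 → w = 0
    · obtain ⟨K, hK⟩ := exists_norm_le_of_sign A s hs
      exact ⟨K, fun _ => hK⟩
    · exact ⟨0, fun h => (hs h).elim⟩
  choose K hK using hK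
  refine ⟨Fintype.card ι * ∑ s, |K s|, by positivity, fun μ hμ lam hlam => ?_⟩
  set y := ∑ i, lam i • a i with hy
  have hcomp : IsCompact (stdSimplex ℝ ι ∩ {ν | ∑ i, ν i • a i = y}) :=
    (isCompact_stdSimplex ℝ ι).inter_right (isClosed_eq (by fun_prop) continuous_const)
  -- ν is the representation of y that is ℓ¹-closest to μ.
  obtain ⟨ν, ⟨hν, hνy⟩, hmin⟩ := hcomp.exists_isMinOn ⟨lam, hlam, rfl⟩
    (f := fun ν : ι → ℝ => ∑ i, |ν i - μ i|) (Continuous.continuousOn (by fun_prop))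
  refine ⟨ν, hν, hνy, ?_⟩
  set w : ι → ℝ := ν - μ with hw
  -- A nonzero kernel vector w' sign-compatible with ν - μ would contradict minimality: subtracting
  -- a small multiple t w' from ν still represents y, keeps each weight between those of μ and ν,
  -- and lowers the distance by t ∑ |w' i|.
  have hker : ∀ w' : ι → ℝ, (∀ i, SignType.sign (w' i) = SignType.sign (w i) ∨ w' i = 0) →
      A w' = 0 → w' = 0 := by
    intro w' hsign hAw'
    by_contra hne
    have hA1 : ∑ i, w' i • a i = 0 := by rw [← hA₁]; exact congrArg Prod.fst hAw'
    have hA2 : ∑ i, w' i = 0 := by rw [← hA₂]; exact congrArg Prod.snd hAw'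
    have hprod : ∀ i, w' i = 0 ∨ 0 < w' i ∧ 0 < w i ∨ w' i < 0 ∧ w i < 0 := by
      intro i
      rcases hsign i with h | h
      · rcases lt_trichotomy (w' i) 0 with h' | h' | h'
        · rw [sign_neg h', eq_comm, sign_eq_neg_one_iff] at h
          exact Or.inr (Or.inr ⟨h', h⟩)
        · exact Or.inl h'
        · rw [sign_pos h', eq_comm, sign_eq_one_iff] at h
          exact Or.inr (Or.inl ⟨h', h⟩)
      · exact Or.inl h
    have hev : ∀ᶠ t : ℝ in nhdsWithin 0 (Set.Ioi 0), ∀ i, |t * w' i| ≤ |w i| := by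
      rw [Filter.eventually_all]
      intro i
      by_cases h0 : w i = 0
      · have : w' i = 0 := by
          rcases hprod i with h | h | h
          · exact h
          · exact absurd h0 h.2.ne'
          · exact absurd h0 h.2.ne
        simp [this]
      · apply Filter.Eventually.filter_mono nhdsWithin_le_nhds
        have hc : Continuous fun t : ℝ => |t * w' i| := by fun_prop
        have := hc.tendsto 0
        simp only [zero_mul, abs_zero] at this
        exact (this.eventually (gt_mem_nhds (abs_pos.2 h0))).mono fun t ht => le_of_lt ht
    obtain ⟨t, ht, ht0⟩ := (hev.and self_mem_nhdsWithin).exists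
    have ht0 : 0 < t := ht0
    have habs : ∀ i, |ν i - t * w' i - μ i| = |ν i - μ i| - t * |w' i| ∧ 0 ≤ ν i - t * w' i := by
      intro i
      have hti := ht i
      have hwi : w i = ν i - μ i := rfl
      have hνi := hν.1 i
      have hμi := hμ.1 i
      rcases hprod i with h | ⟨h1, h2⟩ | ⟨h1, h2⟩
      · simp [h, hνi]
      · have h3 : 0 < t * w' i := mul_pos ht0 h1
        rw [abs_of_pos h3, abs_of_pos h2] at hti
        rw [hwi] at hti h2
        rw [abs_of_nonneg (by linarith), abs_of_pos h2, abs_of_pos h1]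
        exact ⟨by ring, by linarith⟩
      · have h3 : t * w' i < 0 := mul_neg_of_pos_of_neg ht0 h1
        rw [abs_of_neg h3, abs_of_neg h2] at hti
        rw [hwi] at hti h2
        rw [abs_of_nonpos (by linarith), abs_of_neg h2, abs_of_neg h1]
        exact ⟨by ring, by linarith⟩
    have hmem : (fun i => ν i - t * w' i) ∈ stdSimplex ℝ ι ∩ {ν | ∑ i, ν i • a i = y} := by
      refine ⟨⟨fun i => (habs i).2, ?_⟩, ?_⟩
      · rw [Finset.sum_sub_distrib, ← Finset.mul_sum, hA2, mul_zero, sub_zero, hν.2]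
      · simp only [Set.mem_ofPred_eq, sub_smul, mul_smul, Finset.sum_sub_distrib,
          ← Finset.smul_sum, hA1, smul_zero, sub_zero]
        exact hνy
    have hle : ∑ i, |ν i - μ i| ≤ ∑ i, |ν i - t * w' i - μ i| := hmin hmem
    simp only [fun i => (habs i).1, Finset.sum_sub_distrib, ← Finset.mul_sum] at hle
    obtain ⟨i, hi⟩ := Function.ne_iff.1 hne
    have hpos : 0 < ∑ i, |w' i| :=
      Finset.sum_pos' (fun i _ => abs_nonneg _) ⟨i, Finset.mem_univ i, abs_pos.2 hi⟩
    nlinarith [mul_pos ht0 hpos]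
  have hbound := hK (fun i => SignType.sign (w i)) hker w fun i => rfl
  have hAw : ‖A w‖ = ‖y - ∑ i, μ i • a i‖ := by
    have h1 : A w = (y - ∑ i, μ i • a i, 0) := by
      refine Prod.ext ?_ ?_
      · change A₁ w = _
        rw [hA₁, ← hνy, ← Finset.sum_sub_distrib]
        exact Finset.sum_congr rfl fun i _ => by rw [hw, Pi.sub_apply, sub_smul]
      · change A₂ w = _
        rw [hA₂]
        simp only [hw, Pi.sub_apply, Finset.sum_sub_distrib, hν.2, hμ.2, sub_self]
    rw [h1, Prod.norm_def]
    simp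
  rw [hAw] at hbound
  calc ∑ i, |ν i - μ i| ≤ ∑ _i : ι, ‖w‖ := Finset.sum_le_sum fun i _ => norm_le_pi_norm w i
    _ = Fintype.card ι * ‖w‖ := by simp
    _ ≤ Fintype.card ι * ((∑ s, |K s|) * ‖y - ∑ i, μ i • a i‖) := by
        gcongr
        refine hbound.trans (mul_le_mul_of_nonneg_right ((le_abs_self _).trans ?_) (norm_nonneg _))
        exact Finset.single_le_sum (f := fun s => |K s|) (fun s _ => abs_nonneg _)
          (Finset.mem_univ _)
    _ = _ := by ring

end Hoffman

/-! ### Vertex representations and the pairwise gap -/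

/-- `μ` is a system of convex weights on the vertices that represents `x`. -/
structure IsRep {p m : ℕ} (C : Fin m → E p) (b : Fin m → ℝ) (x : E p) (μ : E p →₀ ℝ) :
    Prop where
  support_subset : ∀ v ∈ μ.support, v ∈ vertices C b
  nonneg : ∀ v, 0 ≤ μ v
  sum_eq_one : (μ.sum fun _ a => a) = 1
  sum_eq : (μ.sum fun v a => a • v) = x

section Representation

variable {p m : ℕ} {C : Fin m → E p} {b : Fin m → ℝ} {x : E p} {μ : E p →₀ ℝ}

theorem IsRep.mem_polytope (h : IsRep C b x μ) : x ∈ polytope C b := by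
  rw [← h.sum_eq]
  exact (convex_polytope C b).sum_mem (fun v _ => h.nonneg v) h.sum_eq_one
    fun v hv => (h.support_subset v hv).1

theorem IsRep.support_nonempty (h : IsRep C b x μ) : μ.support.Nonempty := by
  rw [Finset.nonempty_iff_ne_empty]
  intro he
  have h1 := h.sum_eq_one
  rw [Finsupp.sum, he, Finset.sum_empty] at h1
  exact zero_ne_one h1

theorem isRep_single {v : E p} (hv : v ∈ vertices C b) :
    IsRep C b v (Finsupp.single v 1) where
  support_subset w hw := by
    rw [Finset.mem_singleton.1 (Finsupp.support_single_subset hw)]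
    exact hv
  nonneg w := by
    classical
    rw [Finsupp.single_apply]
    split <;> norm_num
  sum_eq_one := by simp
  sum_eq := by simp

/-- Facial-distance type bound: the pairwise gap controls the directional slope from `x` to any
other point of the polytope. -/
theorem exists_pairwise_gap_bound (hc : IsCompact (polytope C b)) :
    ∃ K : ℝ, 0 ≤ K ∧ ∀ (x : E p) (μ : E p →₀ ℝ), IsRep C b x μ → ∀ y ∈ polytope C b,
      ∀ g u v : E p, (∀ w ∈ μ.support, inner ℝ g w ≤ inner ℝ g u) →
        (∀ w ∈ vertices C b, inner ℝ g v ≤ inner ℝ g w) →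
        inner ℝ g (x - y) ≤ K * ‖x - y‖ * (inner ℝ g u - inner ℝ g v) := by
  have hfin := finite_vertices C b
  let := hfin.fintype
  obtain ⟨K, hK0, hK⟩ := exists_lipschitz_weights (fun v : vertices C b => (v : E p))
  refine ⟨K, hK0, fun x μ hμ y hy g u v hu hv => ?_⟩
  have hsum : ∀ {M : Type} [AddCommMonoid M] (φ : E p → ℝ → M), (∀ v, φ v 0 = 0) →
      μ.sum φ = ∑ i : vertices C b, φ i (μ i) := by
    intro M _ φ hφ
    rw [Finsupp.sum_of_support_subset μ (s := hfin.toFinset)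
      (fun v hv => hfin.mem_toFinset.2 (hμ.support_subset v hv)) φ fun v _ => hφ v]
    exact Finset.sum_subtype _ (fun v => hfin.mem_toFinset) _
  have hμs : (fun i : vertices C b => μ i) ∈ stdSimplex ℝ (vertices C b) := by
    refine ⟨fun i => hμ.nonneg i, ?_⟩
    rw [← hμ.sum_eq_one, hsum _ fun _ => rfl]
  have hμx : ∑ i : vertices C b, μ i • (i : E p) = x := by
    rw [← hμ.sum_eq, hsum _ fun v => zero_smul ℝ v]
  obtain ⟨lam, hlam, hlamy⟩ : ∃ lam ∈ stdSimplex ℝ (vertices C b),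
      ∑ i : vertices C b, lam i • (i : E p) = y := by
    rw [← convexHull_vertices hc, hfin.convexHull_eq_image] at hy
    obtain ⟨lam, hlam, h⟩ := hy
    exact ⟨lam, hlam, by simpa using h⟩
  obtain ⟨ν, hν, hνy, hνμ⟩ := hK _ hμs lam hlam
  simp only [hlamy, hμx] at hνy hνμ
  have hvu : inner ℝ g v ≤ inner ℝ g u := by
    obtain ⟨w, hw⟩ := hμ.support_nonempty
    exact (hv w (hμ.support_subset w hw)).trans (hu w hw)
  -- Both weight systems sum to 1, so all linear values may be measured from the minimum ⟨g, v⟩.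
  have h1 : inner ℝ g (x - y) =
      ∑ i : vertices C b, (μ i - ν i) * (inner ℝ g (i : E p) - inner ℝ g v) := by
    simp only [mul_sub, Finset.sum_sub_distrib, ← Finset.sum_mul, sub_mul, hμs.2, hν.2]
    rw [← hμx, ← hνy, inner_sub_right, inner_sum, inner_sum]
    simp only [real_inner_smul_right]
    ring
  -- Only vertices that lose weight contribute positively; those are active for μ, so their value is
  -- at most ⟨g, u⟩.
  have h2 : ∀ i : vertices C b, (μ i - ν i) * (inner ℝ g (i : E p) - inner ℝ g v) ≤
      |ν i - μ i| * (inner ℝ g u - inner ℝ g v) := by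
    intro i
    have hi := hv i i.2
    rcases le_or_gt (μ i - ν i) 0 with h | h
    · exact (mul_nonpos_of_nonpos_of_nonneg h (sub_nonneg.2 hi)).trans
        (mul_nonneg (abs_nonneg _) (sub_nonneg.2 hvu))
    · have hpos : μ i ≠ 0 := by have := hν.1 i; linarith
      have := hu i (Finsupp.mem_support_iff.2 hpos)
      rw [abs_sub_comm, abs_of_pos h]
      gcongr
  calc inner ℝ g (x - y) ≤ ∑ i, |ν i - μ i| * (inner ℝ g u - inner ℝ g v) :=
        h1.trans_le (Finset.sum_le_sum fun i _ => h2 i)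
    _ = (∑ i, |ν i - μ i|) * (inner ℝ g u - inner ℝ g v) := by rw [Finset.sum_mul]
    _ ≤ _ := by
        rw [norm_sub_rev x y]
        exact mul_le_mul_of_nonneg_right hνμ (sub_nonneg.2 hvu)

/-- Moving the weight `γ` from the active vertex `u` to the vertex `v`. -/
theorem IsRep.move (h : IsRep C b x μ) {u v : E p} {γ : ℝ} (hu : u ∈ μ.support)
    (hv : v ∈ vertices C b) (hγ0 : 0 ≤ γ) (hγ : γ ≤ μ u) :
    IsRep C b (x + γ • (v - u)) (μ + Finsupp.single v γ - Finsupp.single u γ) where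
  support_subset w hw := by
    classical
    by_cases hwv : w = v
    · exact hwv ▸ hv
    by_cases hwu : w = u
    · exact hwu ▸ h.support_subset u hu
    refine h.support_subset w ?_
    rw [Finsupp.mem_support_iff] at hw ⊢
    simpa [Finsupp.single_apply, Ne.symm hwv, Ne.symm hwu] using hw
  nonneg w := by
    classical
    have := h.nonneg w
    simp only [Finsupp.coe_sub, Finsupp.coe_add, Pi.sub_apply, Pi.add_apply, Finsupp.single_apply]
    split_ifs with h1 h2 h2
    · linarith
    · linarith
    · subst h2; linarith
    · linarith
  sum_eq_one := by
    rw [Finsupp.sum_sub_index (fun _ _ _ => rfl), Finsupp.sum_add_index' (fun _ => rfl)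
      (fun _ _ _ => rfl), Finsupp.sum_single_index rfl, Finsupp.sum_single_index rfl,
      h.sum_eq_one]
    ring
  sum_eq := by
    rw [Finsupp.sum_sub_index (fun v _ _ => sub_smul _ _ v), Finsupp.sum_add_index'
      (fun v => zero_smul ℝ v) (fun v _ _ => add_smul _ _ v),
      Finsupp.sum_single_index (zero_smul ℝ v), Finsupp.sum_single_index (zero_smul ℝ u),
      h.sum_eq]
    module

/-- A step of maximal length empties u. The case u = v must be excluded, since then the weight
returns to u. -/
theorem support_move_subset {u v : E p} (huv : u ≠ v) :
    ∀ w ∈ (μ + Finsupp.single v (μ u) - Finsupp.single u (μ u)).support,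
      w = v ∨ w ∈ μ.support ∧ w ≠ u := by
  classical
  intro w hw
  by_cases hwv : w = v
  · exact Or.inl hwv
  by_cases hwu : w = u
  · subst hwu
    simp [Ne.symm huv] at hw
  · refine Or.inr ⟨?_, hwu⟩
    rw [Finsupp.mem_support_iff] at hw ⊢
    simpa [Finsupp.single_apply, Ne.symm hwv, Ne.symm hwu] using hw

end Representation

/-! ### Progress of a single iteration -/

/-- Progress of a short step or of an exact line search along a descent direction. -/
theorem IsStepSize.progress {p : ℕ} {Q : E p → ℝ} {G : E p → E p} {σ ℓ Λ D : ℝ}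
    (hQ : IsSmoothStronglyConvex Q G σ ℓ) (hσ : 0 < σ) (hσℓ : σ ≤ ℓ) (hℓ : ℓ ≤ Λ)
    {x d : E p} {γmax γ : ℝ} (hγmax : 0 < γmax) (hd : inner ℝ (G x) d ≤ 0)
    (hdD : ‖d‖ ≤ D) (h : IsStepSize Q ℓ (G x) x d γmax γ) :
    0 ≤ γ ∧ γ ≤ γmax ∧ σ / 4 * ‖γ • d‖ ^ 2 ≤ Q x - Q (x + γ • d) ∧
      (inner ℝ (G x) d ^ 2 / (2 * Λ * D ^ 2) ≤ Q x - Q (x + γ • d) ∨ γ = γmax) := by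
  have hℓ0 : 0 < ℓ := hσ.trans_le hσℓ
  have hΛ : 0 < Λ := hℓ0.trans_le hℓ
  -- For d = 0 the short-step quotient is 0 by the convention for division by zero, and the gap
  -- vanishes.
  rcases eq_or_ne d 0 with rfl | hd0
  · have h1 : 0 ≤ γ ∧ γ ≤ γmax := by
      rcases h with h | h
      · simp only [inner_zero_right, neg_zero, zero_div, min_eq_left hγmax.le] at h
        exact ⟨h.ge, h.trans_le hγmax.le⟩
      · exact h.1
    exact ⟨h1.1, h1.2, by simp, Or.inl (by simp)⟩
  have hn : 0 < ‖d‖ ^ 2 := by have := norm_pos_iff.2 hd0; positivity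
  have hnD : ‖d‖ ^ 2 ≤ D ^ 2 := by gcongr
  set δ := -(inner ℝ (G x) d) with hδ
  have hδ0 : 0 ≤ δ := by linarith
  have hδ2 : inner ℝ (G x) d ^ 2 = δ ^ 2 := by rw [hδ]; ring
  have hupper : ∀ t : ℝ, Q (x + t • d) ≤ Q x - t * δ + ℓ / 2 * (t ^ 2 * ‖d‖ ^ 2) := by
    intro t
    have := hQ.upper x (x + t • d)
    rw [add_sub_cancel_left, real_inner_smul_right, norm_smul, mul_pow, Real.norm_eq_abs,
      sq_abs] at this
    linarith
  have hnorm : ∀ t : ℝ, ‖t • d‖ ^ 2 = t ^ 2 * ‖d‖ ^ 2 := fun t => by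
    rw [norm_smul, mul_pow, Real.norm_eq_abs, sq_abs]
  -- τ minimizes the quadratic upper model along d, ignoring the cap γmax.
  set τ := δ / (ℓ * ‖d‖ ^ 2) with hτ
  have hτ0 : 0 ≤ τ := by positivity
  have hτeq : τ * (ℓ * ‖d‖ ^ 2) = δ := div_mul_cancel₀ _ (by positivity)
  have hfull : inner ℝ (G x) d ^ 2 / (2 * Λ * D ^ 2) ≤ Q x - Q (x + τ • d) := by
    have h1 := hupper τ
    have h2 : δ ^ 2 / (2 * Λ * D ^ 2) ≤ δ ^ 2 / (2 * ℓ * ‖d‖ ^ 2) := by gcongr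
    have h3 : δ ^ 2 / (2 * ℓ * ‖d‖ ^ 2) = τ * δ - ℓ / 2 * (τ ^ 2 * ‖d‖ ^ 2) := by
      rw [hτ]
      field_simp
      ring
    rw [hδ2]
    linarith
  rw [hnorm]
  rcases h with h | ⟨hmem, hmin⟩
  · have hγ0 : 0 ≤ γ := by rw [h]; exact le_min hτ0 hγmax.le
    have hγτ : γ ≤ τ := h ▸ min_le_left _ _
    refine ⟨hγ0, h ▸ min_le_right _ _, ?_, ?_⟩
    · have h1 := hupper γ
      have h2 : γ * (ℓ * ‖d‖ ^ 2) ≤ δ := by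
        rw [← hτeq]
        gcongr
      have h3 : γ * (γ * (ℓ * ‖d‖ ^ 2)) ≤ γ * δ := mul_le_mul_of_nonneg_left h2 hγ0
      have h4 : σ * (γ ^ 2 * ‖d‖ ^ 2) ≤ ℓ * (γ ^ 2 * ‖d‖ ^ 2) := by gcongr
      have h5 : 0 ≤ σ * (γ ^ 2 * ‖d‖ ^ 2) := by positivity
      nlinarith
    · rcases min_choice τ γmax with h' | h'
      · left
        rw [h, h']
        exact hfull
      · right
        rw [h, h']
  · refine ⟨hmem.1, hmem.2, ?_, ?_⟩
    -- The midpoint of the step is also admissible for the line search, which is all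
    -- `sub_ge_of_midpoint_ge` requires.
    · have hmid : Q (x + γ • d) ≤ Q ((1 / 2 : ℝ) • (x + (x + γ • d))) := by
        have h1 : Q (x + γ • d) ≤ Q (x + (γ / 2) • d) :=
          hmin (a := γ / 2) ⟨by linarith [hmem.1], by linarith [hmem.1, hmem.2]⟩
        have h2 : (1 / 2 : ℝ) • (x + (x + γ • d)) = x + (γ / 2) • d := by module
        rwa [h2]
      have := hQ.sub_ge_of_midpoint_ge hmid
      rwa [add_sub_cancel_left, hnorm] at this
    · rcases le_or_gt τ γmax with hle | hlt
      · left
        have h1 : Q (x + γ • d) ≤ Q (x + τ • d) := hmin (a := τ) ⟨hτ0, hle⟩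
        linarith
      · right
        -- When τ exceeds γmax, the line search must end at γmax: from any shorter step, the slope
        -- is still negative enough that continuing to γmax strictly decreases Q.
        by_contra hne
        have hlt' : γ < γmax := lt_of_le_of_ne hmem.2 hne
        set t := γmax - γ with ht
        have ht0 : 0 < t := by linarith
        have h1 : Q (x + γ • d) ≤ Q (x + γmax • d) := hmin (a := γmax) ⟨hγmax.le, le_rfl⟩
        have h2 := hQ.upper (x + γ • d) (x + γmax • d)
        have e1 : x + γmax • d - (x + γ • d) = t • d := by rw [ht]; module
        rw [e1, real_inner_smul_right, hnorm] at h2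
        have h3 := hQ.lip x (x + γ • d)
        rw [add_sub_cancel_left, norm_smul, Real.norm_of_nonneg hmem.1] at h3
        have h4 : inner ℝ (G (x + γ • d)) d ≤ -δ + ℓ * (γ * ‖d‖ ^ 2) := by
          have h5 := real_inner_le_norm (G (x + γ • d) - G x) d
          rw [inner_sub_left] at h5
          nlinarith [norm_nonneg d]
        have h6 : γmax * (ℓ * ‖d‖ ^ 2) < δ := by
          rw [← hτeq]
          gcongr
        have h7 : γmax = γ + t := by rw [ht]; ring
        rw [h7] at h6
        have h8 := mul_le_mul_of_nonneg_left h4 ht0.le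
        have h9 := mul_lt_mul_of_pos_left h6 ht0
        have h10 : 0 < ℓ * (t ^ 2 * ‖d‖ ^ 2) := by positivity
        nlinarith

/-- One iteration of the algorithm: the representation stays valid, the sampled objective decreases
quadratically in the length of the step, and either it decreases quadratically in the pairwise gap
or the away vertex `u` leaves the support, to which at most `v` is added. -/
theorem IsStep.progress {n p m M : ℕ} {C : Fin m → E p} {b : Fin m → ℝ} {f : Fin n → E p → ℝ}
    {L : Fin n → NNReal} {carath : Bool} {s : Fin M → Fin n} {x x' : E p} {μ μ' : E p →₀ ℝ}
    (h : IsStep C b f L carath s x μ x' μ') (hμ : IsRep C b x μ) {σ Λ D : ℝ}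
    (hQ : IsSmoothStronglyConvex (batchObjective f s) (batchGradient f s) σ (batchLipschitz L s))
    (hσ : 0 < σ) (hσℓ : σ ≤ batchLipschitz L s) (hℓ : batchLipschitz L s ≤ Λ)
    (hPD : ∀ y ∈ polytope C b, ∀ z ∈ polytope C b, ‖y - z‖ ≤ D) :
    IsRep C b x' μ' ∧ ∃ u v : E p, v ∈ vertices C b ∧
      (∀ y ∈ polytope C b, inner ℝ (batchGradient f s x) v ≤ inner ℝ (batchGradient f s x) y) ∧
      u ∈ μ.support ∧
      (∀ w ∈ μ.support, inner ℝ (batchGradient f s x) w ≤ inner ℝ (batchGradient f s x) u) ∧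
      σ / 4 * ‖x' - x‖ ^ 2 ≤ batchObjective f s x - batchObjective f s x' ∧
      ((inner ℝ (batchGradient f s x) u - inner ℝ (batchGradient f s x) v) ^ 2 /
          (2 * Λ * D ^ 2) ≤ batchObjective f s x - batchObjective f s x' ∨
        ∀ w ∈ μ'.support, w = v ∨ w ∈ μ.support ∧ w ≠ u) := by
  obtain ⟨v, u, γ, ⟨hv, hvmin⟩, ⟨hu, humax⟩, hγ, rfl, hμ'⟩ := h
  have hvmin' : ∀ y ∈ polytope C b,
      inner ℝ (batchGradient f s x) v ≤ inner ℝ (batchGradient f s x) y := fun y hy => hvmin hy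
  have huV := hμ.support_subset u hu
  have hμu : 0 < μ u := (hμ.nonneg u).lt_of_ne (Finsupp.mem_support_iff.1 hu).symm
  have hd : inner ℝ (batchGradient f s x) (v - u) ≤ 0 := by
    rw [inner_sub_right]
    linarith [hvmin' u huV.1]
  obtain ⟨h0, h1, h2, h3⟩ := hγ.progress hQ hσ hσℓ hℓ hμu hd (hPD v hv.1 u huV.1)
  have hmove := hμ.move hu hv h0 h1
  have hsub : μ'.support ⊆ (μ + Finsupp.single v γ - Finsupp.single u γ).support := by
    split at hμ'
    · exact hμ'.support_subset
    · rw [hμ']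
  refine ⟨?_, u, v, hv, hvmin', hu, humax, by rwa [add_sub_cancel_left], ?_⟩
  · split at hμ'
    · exact ⟨fun w hw => hmove.support_subset w (hsub hw), hμ'.nonneg, hμ'.sum_eq_one,
        hμ'.sum_eq⟩
    · rw [hμ']
      exact hmove
  · rcases h3 with h3 | h3
    · left
      rw [inner_sub_right, ← neg_sub (inner ℝ (batchGradient f s x) u), neg_sq] at h3
      exact h3
    -- If u = v, nothing is dropped, but the pairwise gap is 0 and the first alternative is trivial.
    · by_cases huv : u = v
      · left
        subst huv
        simp
      · right
        intro w hw
        have := hsub hw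
        rw [h3] at this
        exact support_move_subset huv w this

/-! ### Contraction over a block of iterations -/

/-- An inexact pairwise step from `x` (optimality gap `h`, active set `S`) to `x'` (optimality gap
`h'`, active set `S'`), in which the gradient field `G` is known up to the error `δ`. The function
decrease `P` is at least quadratic in the step length, and either it is quadratic in the pairwise
gap `⟨g, u - v⟩` or the step removes `u` from the active set, adding at most `v`. -/
def IsPairwiseStep {F : Type*} [NormedAddCommGroup F] [InnerProductSpace ℝ F] (V : Finset F)
    (G : F → F) (a e K σ : ℝ) (x x' : F) (S S' : Finset F) (h h' δ : ℝ) : Prop :=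
  ∃ (g u v : F) (P : ℝ), h' ≤ h - P + δ * ‖x' - x‖ ∧ a * ‖x' - x‖ ^ 2 ≤ P ∧
    ‖g - G x‖ ≤ δ ∧ v ∈ V ∧ (∀ w ∈ V, inner ℝ g v ≤ inner ℝ g w) ∧ u ∈ S ∧
    2 * σ * h ≤ (K * (inner ℝ g u - inner ℝ g v) + δ) ^ 2 ∧
    (e * (inner ℝ g u - inner ℝ g v) ^ 2 ≤ P ∨ ∀ w ∈ S', w = v ∨ w ∈ S ∧ w ≠ u)

/-- Every upper bound imposed on q holds strictly at q = 0, hence for all small positive q by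
continuity. -/
theorem exists_small_rate {a e K ρ ℓ D T : ℝ} (he : 0 < e) (hK : 0 < K) (hρ : 0 < ρ) :
    ∃ q : ℝ, 0 < q ∧ q ≤ 1 / 2 ∧ q ≤ ρ / 2 ∧ 2 * q ^ 2 < e * (ρ / (2 * K)) ^ 2 ∧
      q * (1 + ℓ * (T * a)) * D ≤ ρ / (2 * K) / 8 := by
  have h1 : ∀ φ : ℝ → ℝ, Continuous φ → ∀ r, φ 0 < r →
      ∀ᶠ q in nhdsWithin (0 : ℝ) (Set.Ioi 0), φ q < r := fun φ hφ r hr =>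
    ((hφ.tendsto 0).eventually (gt_mem_nhds hr)).filter_mono nhdsWithin_le_nhds
  have hβ : 0 < ρ / (2 * K) := by positivity
  have h0 : ∀ᶠ q in nhdsWithin (0 : ℝ) (Set.Ioi 0), 0 < q := self_mem_nhdsWithin
  obtain ⟨q, h0, h2, h3, h4, h5⟩ := (h0.and
    ((h1 (fun q => q) continuous_id (1 / 2) (by norm_num)).and
    ((h1 (fun q => q) continuous_id (ρ / 2) (by positivity)).and
    ((h1 (fun q => 2 * q ^ 2) (by fun_prop) (e * (ρ / (2 * K)) ^ 2)
      (by rw [zero_pow two_ne_zero, mul_zero]; positivity)).and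
    (h1 (fun q => q * (1 + ℓ * (T * a)) * D) (by fun_prop) (ρ / (2 * K) / 8)
      (by simp only [zero_mul]; positivity)))))).exists
  exact ⟨q, h0, h2.le, h3.le, h4, h5.le⟩

/-- A block of `|V| + 1` inexact pairwise steps contracts the optimality gap by a fixed factor, up
to the squared gradient errors. Otherwise the iterate would hardly move during the block, so that
the gradients are nearly constant, every step removes a vertex with a high linear value from the
active set and adds only vertices with a low one; the high vertices would be exhausted. -/
theorem exists_block_contraction {F : Type*} [NormedAddCommGroup F] [InnerProductSpace ℝ F]
    (V : Finset F) {a e K σ ℓ D : ℝ} (ha : 0 < a) (he : 0 < e) (hK : 0 < K) (hσ : 0 < σ)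
    (hℓ : 0 ≤ ℓ) (hD : ∀ v ∈ V, ∀ w ∈ V, ‖v - w‖ ≤ D) :
    ∃ c A : ℝ, 0 < c ∧ c < 1 ∧ 0 ≤ A ∧ ∀ (G : F → F) (x : ℕ → F) (S : ℕ → Finset F)
      (h δ : ℕ → ℝ), (∀ j, 0 ≤ h j) → (∀ j, 0 ≤ δ j) → (∀ j, S j ⊆ V) →
      (∀ j, ‖G (x j) - G (x 0)‖ ≤ ℓ * ‖x j - x 0‖) →
      (∀ j, IsPairwiseStep V G a e K σ (x j) (x (j + 1)) (S j) (S (j + 1)) (h j) (h (j + 1))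
        (δ j)) →
      h (V.card + 1) ≤ (1 - c) * h 0 + A * ∑ j ∈ Finset.range (V.card + 1), δ j ^ 2 := by
  classical
  set ρ := √σ with hρdef
  have hρ : 0 < ρ := Real.sqrt_pos.2 hσ
  have hρσ : ρ ^ 2 = σ := Real.sq_sqrt hσ.le
  set r := √(2 / a) with hrdef
  have hr : 0 ≤ r := Real.sqrt_nonneg _
  have hra : a * r ^ 2 = 2 := by
    rw [hrdef, Real.sq_sqrt (by positivity)]
    field_simp
  set T := V.card + 1 with hT
  obtain ⟨q, hq0, hq1, hqρ, hqe, hqD⟩ :=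
    exists_small_rate (a := r) (ℓ := ℓ) (D := D) (T := (T : ℝ)) he hK hρ
  set β := ρ / (2 * K) with hβdef
  have hβ : 0 < β := by positivity
  -- In A, the term 1 / (2a) pays for Young's inequality; the extra 1 makes failure of the
  -- contraction force every δ j to be small.
  refine ⟨q ^ 2, 1 / (2 * a) + 1, by positivity, by nlinarith, by positivity, ?_⟩
  intro G x S h δ hh hδ hSV hG hstep
  choose g u v P h1 h2 h3 hvV hvmin huS hgap halt using hstep
  by_contra! hcon
  have hP : ∀ j, 0 ≤ P j := fun j => (by positivity : 0 ≤ a * ‖x (j + 1) - x j‖ ^ 2).trans (h2 j)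
  have hdec : ∀ j, h (j + 1) ≤ h j - P j / 2 + δ j ^ 2 / (2 * a) := by
    intro j
    have hyoung : δ j * ‖x (j + 1) - x j‖ ≤
        δ j ^ 2 / (2 * a) + a * ‖x (j + 1) - x j‖ ^ 2 / 2 := by
      have e1 : δ j ^ 2 / (2 * a) + a * ‖x (j + 1) - x j‖ ^ 2 / 2 - δ j * ‖x (j + 1) - x j‖ =
          (δ j - a * ‖x (j + 1) - x j‖) ^ 2 / (2 * a) := by
        field_simp
        ring
      have e2 : 0 ≤ (δ j - a * ‖x (j + 1) - x j‖) ^ 2 / (2 * a) := by positivity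
      linarith
    linarith [h1 j, h2 j]
  set E : ℝ := ∑ j ∈ Finset.range T, δ j ^ 2 with hE
  set PS : ℝ := ∑ j ∈ Finset.range T, P j with hPS
  -- This potential telescopes the decrease. Comparing index T with index 0 bounds all P j, and with
  -- index j shows that h j stays above half of h 0.
  have hanti : Antitone fun j => h j + (∑ i ∈ Finset.range j, P i) / 2 -
      (∑ i ∈ Finset.range j, δ i ^ 2) / (2 * a) := by
    apply antitone_nat_of_succ_le
    intro j
    rw [Finset.sum_range_succ, Finset.sum_range_succ, add_div, add_div]
    linarith [hdec j]
  have hE0 : 0 ≤ E := Finset.sum_nonneg fun j _ => sq_nonneg _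
  have hEa : 0 ≤ E / (2 * a) := by positivity
  have hPS0 : 0 ≤ PS := Finset.sum_nonneg fun j _ => hP j
  have hA : (1 / (2 * a) + 1) * E = E / (2 * a) + E := by ring
  rw [hA] at hcon
  have hsmall : E + PS / 2 < q ^ 2 * h 0 := by
    have := hanti (Nat.zero_le T)
    simp only [Finset.range_zero, Finset.sum_empty, zero_div, add_zero, sub_zero] at this
    linarith
  have hh0 : 0 < h 0 := by
    by_contra! hle
    have : q ^ 2 * h 0 ≤ 0 := mul_nonpos_of_nonneg_of_nonpos (sq_nonneg q) hle
    linarith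
  have hhj : ∀ j < T, h 0 / 2 ≤ h j := by
    intro j hj
    have e1 := hanti hj.le
    have e2 : ∑ i ∈ Finset.range j, P i ≤ PS :=
      Finset.sum_le_sum_of_subset_of_nonneg (Finset.range_mono hj.le) fun i _ _ => hP i
    have e3 : 0 ≤ (∑ i ∈ Finset.range j, δ i ^ 2) / (2 * a) :=
      div_nonneg (Finset.sum_nonneg fun i _ => sq_nonneg _) (by positivity)
    have e4 : q ^ 2 * h 0 ≤ 1 / 2 * h 0 := by
      gcongr
      nlinarith
    simp only at e1
    linarith
  -- All lengths, errors and gaps in the block are measured in units of s.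
  set s := √(h 0) with hs
  have hs0 : 0 < s := Real.sqrt_pos.2 hh0
  have hss : s ^ 2 = h 0 := Real.sq_sqrt hh0.le
  rw [← hss] at hsmall
  have hδj : ∀ j < T, δ j ≤ q * s := by
    intro j hj
    have e1 : δ j ^ 2 ≤ E := Finset.single_le_sum (f := fun j => δ j ^ 2)
      (fun i _ => sq_nonneg _) (Finset.mem_range.2 hj)
    exact le_of_sq_le_sq (by rw [mul_pow]; linarith) (by positivity)
  have hPj : ∀ j < T, P j < 2 * q ^ 2 * s ^ 2 := by
    intro j hj
    have e1 : P j ≤ PS := Finset.single_le_sum (fun i _ => hP i) (Finset.mem_range.2 hj)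
    linarith
  have hΔ : ∀ j < T, ‖x (j + 1) - x j‖ ≤ q * r * s := by
    intro j hj
    refine le_of_sq_le_sq ?_ (by positivity)
    have e1 : a * ‖x (j + 1) - x j‖ ^ 2 ≤ a * (q * r * s) ^ 2 := by
      have : a * (q * r * s) ^ 2 = (a * r ^ 2) * (q ^ 2 * s ^ 2) := by ring
      rw [this, hra]
      linarith [h2 j, hPj j hj]
    exact le_of_mul_le_mul_left e1 ha
  have hx : ∀ j ≤ T, ‖x j - x 0‖ ≤ j * (q * r * s) := by
    intro j
    induction j with
    | zero => simp
    | succ j ih =>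
      intro hj
      have e1 := norm_add_le (x (j + 1) - x j) (x j - x 0)
      rw [sub_add_sub_cancel] at e1
      push_cast
      linarith [hΔ j (by omega), ih (by omega)]
  set η := q * (1 + ℓ * (T * r)) with hη
  have hη0 : 0 ≤ η := by positivity
  -- Short total movement and small errors make all gradients of the block nearly equal to the
  -- initial one.
  have hgj : ∀ j < T, ‖g j - G (x 0)‖ ≤ η * s := by
    intro j hj
    have e1 := norm_add_le (g j - G (x j)) (G (x j) - G (x 0))
    rw [sub_add_sub_cancel] at e1
    have e2 : ‖x j - x 0‖ ≤ T * (q * r * s) := by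
      refine (hx j hj.le).trans ?_
      gcongr
    have e3 : ℓ * ‖x j - x 0‖ ≤ ℓ * (T * (q * r * s)) := by gcongr
    have e4 : η * s = q * s + ℓ * (T * (q * r * s)) := by rw [hη]; ring
    linarith [h3 j, hδj j hj, hG j]
  have hgapj : ∀ j < T, β * s ≤ inner ℝ (g j) (u j) - inner ℝ (g j) (v j) := by
    intro j hj
    have hnn : 0 ≤ inner ℝ (g j) (u j) - inner ℝ (g j) (v j) :=
      sub_nonneg.2 (hvmin j _ (hSV j (huS j)))
    have e1 : (ρ * s) ^ 2 ≤ (K * (inner ℝ (g j) (u j) - inner ℝ (g j) (v j)) + δ j) ^ 2 := by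
      refine le_trans ?_ (hgap j)
      rw [mul_pow, hρσ, hss]
      nlinarith [hhj j hj]
    have e2 := le_of_sq_le_sq e1 (add_nonneg (mul_nonneg hK.le hnn) (hδ j))
    have e3 : q * s ≤ ρ / 2 * s := by gcongr
    have e4 : K * (β * s) = ρ / 2 * s := by
      rw [hβdef]
      field_simp
    have e5 := hδj j hj
    exact le_of_mul_le_mul_left (by linarith) hK
  -- A decrease quadratic in the gap would exceed the bound on P j, so every step of the block is a
  -- drop step.
  have hswap : ∀ j < T, ∀ w ∈ S (j + 1), w = v j ∨ w ∈ S j ∧ w ≠ u j := by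
    intro j hj
    refine (halt j).resolve_left fun hle => ?_
    have e1 : e * (β * s) ^ 2 ≤ e * (inner ℝ (g j) (u j) - inner ℝ (g j) (v j)) ^ 2 := by
      have := hgapj j hj
      gcongr
    have e2 : 2 * q ^ 2 * s ^ 2 < e * β ^ 2 * s ^ 2 := by gcongr
    rw [mul_pow] at e1
    linarith [hPj j hj]
  have hinner : ∀ j < T, ∀ w ∈ V, ∀ w' ∈ V,
      inner ℝ (g j) w - inner ℝ (g j) w' - β / 8 * s ≤
        inner ℝ (G (x 0)) w - inner ℝ (G (x 0)) w' := by
    intro j hj w hw w' hw'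
    have e1 := real_inner_le_norm (g j - G (x 0)) (w - w')
    rw [inner_sub_left, inner_sub_right, inner_sub_right] at e1
    have e2 : ‖g j - G (x 0)‖ * ‖w - w'‖ ≤ η * s * D :=
      mul_le_mul (hgj j hj) (hD w hw w' hw') (norm_nonneg _) (by positivity)
    have e3 : η * s * D ≤ β / 8 * s := by
      have := mul_le_mul_of_nonneg_right hqD hs0.le
      linarith
    linarith
  have hT0 : 0 < T := Nat.succ_pos _
  -- The threshold between low and high vertices: replacing g j by G (x 0) changes differences of
  -- values by at most β s / 8, so each v j is at most β s / 8 above v 0 and each u j at least 3 β s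
  -- / 4 above it.
  set τ := inner ℝ (G (x 0)) (v 0) + β / 2 * s with hτ
  have hβs : 0 < β * s := by positivity
  -- Each step removes one high vertex and adds none; at j = |V| + 1 the count is absurd, which
  -- explains the block length.
  have hcard : ∀ j ≤ T, ((S j).filter fun w => τ ≤ inner ℝ (G (x 0)) w).card + j ≤ V.card := by
    intro j
    induction j with
    | zero =>
      intro _
      exact Finset.card_le_card ((Finset.filter_subset _ _).trans (hSV 0))
    | succ j ih =>
      intro hj
      have hj' : j < T := hj
      have hlow : inner ℝ (G (x 0)) (v j) < τ := by
        have e1 := hinner j hj' _ (hvV 0) _ (hvV j)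
        have e2 := hvmin j _ (hvV 0)
        rw [hτ]
        linarith
      have hhigh : τ ≤ inner ℝ (G (x 0)) (u j) := by
        have e1 := hinner j hj' _ (hSV j (huS j)) _ (hvV j)
        have e2 := hinner 0 hT0 _ (hvV j) _ (hvV 0)
        have e3 := hvmin 0 _ (hvV j)
        have e4 := hgapj j hj'
        rw [hτ]
        linarith
      have hmem : u j ∈ (S j).filter fun w => τ ≤ inner ℝ (G (x 0)) w :=
        Finset.mem_filter.2 ⟨huS j, hhigh⟩
      have hsub : ((S (j + 1)).filter fun w => τ ≤ inner ℝ (G (x 0)) w) ⊆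
          ((S j).filter fun w => τ ≤ inner ℝ (G (x 0)) w).erase (u j) := by
        intro w hw
        rw [Finset.mem_filter] at hw
        rcases hswap j hj' w hw.1 with rfl | ⟨hw1, hw2⟩
        · exact absurd hw.2 (not_le.2 hlow)
        · exact Finset.mem_erase.2 ⟨hw2, Finset.mem_filter.2 ⟨hw1, hw.2⟩⟩
      have e1 := Finset.card_le_card hsub
      rw [Finset.card_erase_of_mem hmem] at e1
      have e2 := Finset.card_pos.2 ⟨_, hmem⟩
      have e3 := ih hj'.le
      omega
  have := hcard T le_rfl
  omega

/-! ### Batches as weighted averages -/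

/-- The empirical frequency of the index `i` in the batch `s`. -/
noncomputable def batchFreq {n M : ℕ} (s : Fin M → Fin n) (i : Fin n) : ℝ :=
  (1 / (M : ℝ)) * ∑ j, if s j = i then 1 else 0

/-- The `ℓ¹`-distance of the empirical frequencies from the uniform distribution. -/
noncomputable def sampleError {n M : ℕ} (s : Fin M → Fin n) : ℝ :=
  ∑ i, |batchFreq s i - 1 / n|

/-- The gradient of the objective. -/
noncomputable def objectiveGradient {n p : ℕ} (f : Fin n → E p → ℝ) (x : E p) : E p :=
  ∑ i, (1 / (n : ℝ)) • gradient (f i) x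

section Batch

variable {n p M : ℕ}

/-- Grouping the batch by index turns objective, gradient and Lipschitz constant into averages with
the same weights, so one random vector of frequencies carries all the sampling noise. -/
theorem smul_sum_batch {V : Type*} [AddCommGroup V] [Module ℝ V] (s : Fin M → Fin n)
    (φ : Fin n → V) : (1 / (M : ℝ)) • ∑ j, φ (s j) = ∑ i, batchFreq s i • φ i := by
  simp only [batchFreq, mul_smul, Finset.sum_smul, ← Finset.smul_sum]
  rw [Finset.sum_comm]
  simp

theorem batchFreq_nonneg (s : Fin M → Fin n) (i : Fin n) : 0 ≤ batchFreq s i :=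
  mul_nonneg (by positivity) (Finset.sum_nonneg fun j _ => by split <;> norm_num)

theorem sum_batchFreq (hM : 0 < M) (s : Fin M → Fin n) : ∑ i, batchFreq s i = 1 := by
  have h := smul_sum_batch s fun _ => (1 : ℝ)
  have hM' : (M : ℝ) ≠ 0 := by positivity
  simp only [Finset.sum_const, Finset.card_univ, Fintype.card_fin, smul_eq_mul, mul_one,
    nsmul_eq_mul] at h
  rw [← h]
  field_simp

theorem sum_uniform (hn : 0 < n) : ∑ _i : Fin n, 1 / (n : ℝ) = 1 := by
  have : (n : ℝ) ≠ 0 := by positivity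
  simp [this]

theorem batchObjective_eq (f : Fin n → E p → ℝ) (s : Fin M → Fin n) :
    batchObjective f s = fun x => ∑ i, batchFreq s i * f i x :=
  funext fun x => smul_sum_batch s fun i => f i x

theorem batchGradient_eq (f : Fin n → E p → ℝ) (s : Fin M → Fin n) :
    batchGradient f s = fun x => ∑ i, batchFreq s i • gradient (f i) x :=
  funext fun x => smul_sum_batch s fun i => gradient (f i) x

theorem batchLipschitz_eq (L : Fin n → NNReal) (s : Fin M → Fin n) :
    batchLipschitz L s = ∑ i, batchFreq s i * L i :=
  smul_sum_batch s fun i => (L i : ℝ)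

theorem objective_eq (f : Fin n → E p → ℝ) :
    objective f = fun x => ∑ i, 1 / (n : ℝ) * f i x :=
  funext fun _ => Finset.mul_sum _ _ _

theorem sampleError_nonneg (s : Fin M → Fin n) : 0 ≤ sampleError s :=
  Finset.sum_nonneg fun _ _ => abs_nonneg _

theorem norm_batchGradient_sub_le {f : Fin n → E p → ℝ} {B : ℝ} {x : E p}
    (hB : ∀ i, ‖gradient (f i) x‖ ≤ B) (s : Fin M → Fin n) :
    ‖batchGradient f s x - objectiveGradient f x‖ ≤ B * sampleError s := by
  rw [batchGradient_eq, objectiveGradient, ← Finset.sum_sub_distrib, sampleError, Finset.mul_sum]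
  refine (norm_sum_le _ _).trans (Finset.sum_le_sum fun i _ => ?_)
  rw [← sub_smul, norm_smul, Real.norm_eq_abs, mul_comm]
  exact mul_le_mul_of_nonneg_right (hB i) (abs_nonneg _)

theorem objective_sub_le {f : Fin n → E p → ℝ} {B : ℝ} {x y : E p}
    (hB : ∀ i, |f i x - f i y| ≤ B * ‖x - y‖) (s : Fin M → Fin n) :
    objective f y - objective f x ≤
      batchObjective f s y - batchObjective f s x + B * sampleError s * ‖y - x‖ := by
  rw [batchObjective_eq, objective_eq, sampleError]
  simp only [← Finset.sum_sub_distrib, Finset.mul_sum, Finset.sum_mul, ← Finset.sum_add_distrib]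
  refine Finset.sum_le_sum fun i _ => ?_
  have h1 : (batchFreq s i - 1 / n) * (f i x - f i y) ≤
      |batchFreq s i - 1 / n| * (B * ‖x - y‖) := by
    refine (le_abs_self _).trans ?_
    rw [abs_mul]
    exact mul_le_mul_of_nonneg_left (hB i) (abs_nonneg _)
  rw [norm_sub_rev y x]
  linarith

end Batch

/-! ### Pathwise contraction along a run -/

section Run

variable {n p m : ℕ} {C : Fin m → E p} {b : Fin m → ℝ} {f : Fin n → E p → ℝ}
  {L : Fin n → NNReal}

theorem continuous_objective (hf : ∀ i, Differentiable ℝ (f i)) : Continuous (objective f) := by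
  rw [objective_eq]
  exact continuous_finsetSum _ fun i _ => continuous_const.mul (hf i).continuous

theorem optValue_le (hc : IsCompact (polytope C b)) (hf : ∀ i, Differentiable ℝ (f i)) {y : E p}
    (hy : y ∈ polytope C b) : optValue f C b ≤ objective f y :=
  csInf_le (hc.bddBelow_image (continuous_objective hf).continuousOn) (Set.mem_image_of_mem _ hy)

theorem exists_optimal (hc : IsCompact (polytope C b)) (hn : (polytope C b).Nonempty)
    (hf : ∀ i, Differentiable ℝ (f i)) :
    ∃ y ∈ polytope C b, objective f y = optValue f C b := by
  obtain ⟨y, hy, h⟩ := hc.exists_sInf_image_eq hn (continuous_objective hf).continuousOn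
  exact ⟨y, hy, h.symm⟩

theorem exists_gradient_bound (hc : IsCompact (polytope C b))
    (hlip : ∀ i, LipschitzWith (L i) (gradient (f i))) :
    ∃ B : ℝ, 0 ≤ B ∧ ∀ i, ∀ y ∈ polytope C b, ‖gradient (f i) y‖ ≤ B := by
  have h : ∀ i, ∃ B : ℝ, ∀ y ∈ polytope C b, ‖gradient (f i) y‖ ≤ B := fun i =>
    hc.exists_bound_of_continuousOn (hlip i).continuous.continuousOn
  choose B hB using h
  refine ⟨∑ i, |B i|, by positivity, fun i y hy => (hB i y hy).trans ((le_abs_self _).trans ?_)⟩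
  exact Finset.single_le_sum (f := fun i => |B i|) (fun i _ => abs_nonneg _) (Finset.mem_univ i)

/-- Along every run, a block of `|V| + 1` iterations contracts the optimality gap by a fixed
factor up to the squared sampling errors. -/
theorem exists_run_contraction (hn : 0 < n) (hcompact : IsCompact (polytope C b))
    (hnontrivial : (polytope C b).Nontrivial) {σ : Fin n → ℝ} (hσ : ∀ i, 0 < σ i)
    (hconvex : ∀ i, StrongConvexOn Set.univ (σ i) (f i)) (hdiff : ∀ i, Differentiable ℝ (f i))
    (hlip : ∀ i, LipschitzWith (L i) (gradient (f i))) :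
    ∃ c A : ℝ, 0 < c ∧ c < 1 ∧ 0 ≤ A ∧
      ∀ (carath : Bool) (M : ℕ → ℕ) (s : (k : ℕ) → Fin (M k) → Fin n) (x : ℕ → E p)
        (μ : ℕ → E p →₀ ℝ), (∀ k, 0 < M k) → IsRun C b f L carath s x μ →
        (∀ k, 1 ≤ k → x k ∈ polytope C b) ∧
        ∀ k, 1 ≤ k → objective f (x (k + ((vertices C b).ncard + 1))) - optValue f C b ≤
          (1 - c) * (objective f (x k) - optValue f C b) +
            A * ∑ j ∈ Finset.range ((vertices C b).ncard + 1), sampleError (s (k + j)) ^ 2 := by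
  have : Nonempty (Fin n) := ⟨⟨0, hn⟩⟩
  have : Nontrivial (E p) := by
    obtain ⟨y, -, z, -, h⟩ := hnontrivial
    exact ⟨y, z, h⟩
  have hfin := finite_vertices C b
  obtain ⟨K, hK0, hK⟩ := exists_pairwise_gap_bound hcompact
  obtain ⟨B, hB0, hB⟩ := exists_gradient_bound hcompact hlip
  obtain ⟨xopt, hxopt, hopt⟩ := exists_optimal hcompact hnontrivial.nonempty hdiff
  obtain ⟨i₀, hi₀⟩ := Finite.exists_min σ
  obtain ⟨i₁, hi₁⟩ := Finite.exists_max L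
  set σ₀ := σ i₀
  set Λ : ℝ := (L i₁ : ℝ)
  have hσ₀ : 0 < σ₀ := hσ i₀
  have hfi : ∀ i, IsSmoothStronglyConvex (f i) (gradient (f i)) σ₀ (L i) := fun i =>
    (isSmoothStronglyConvex_gradient (hconvex i) (hdiff i) (hlip i)).mono (hi₀ i) le_rfl
  have hσL : ∀ i, σ₀ ≤ L i := fun i => (hfi i).le_lipschitz
  have hLΛ : ∀ i, (L i : ℝ) ≤ Λ := fun i => NNReal.coe_le_coe.2 (hi₁ i)
  have hΛ : 0 < Λ := hσ₀.trans_le (hσL i₁)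
  have hF : IsSmoothStronglyConvex (objective f) (objectiveGradient f) σ₀ Λ := by
    have h1 : IsSmoothStronglyConvex (objective f) (objectiveGradient f) σ₀
        (∑ i : Fin n, 1 / (n : ℝ) * L i) := by
      rw [objective_eq]
      exact IsSmoothStronglyConvex.weighted_sum (fun _ => by positivity) (sum_uniform hn) hfi
    refine h1.mono le_rfl ?_
    calc ∑ i : Fin n, 1 / (n : ℝ) * L i ≤ ∑ i : Fin n, 1 / (n : ℝ) * Λ := by
          gcongr with i
          exact hLΛ i
      _ = Λ := by rw [← Finset.sum_mul, sum_uniform hn, one_mul]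
  set D := Metric.diam (polytope C b)
  have hD : 0 < D := diam_polytope_pos hcompact hnontrivial
  have hPD : ∀ y ∈ polytope C b, ∀ z ∈ polytope C b, ‖y - z‖ ≤ D := fun y hy z hz => by
    rw [← dist_eq_norm]
    exact Metric.dist_le_diam_of_mem hcompact.isBounded hy hz
  have hmemV : ∀ v, v ∈ hfin.toFinset ↔ v ∈ vertices C b := fun v => hfin.mem_toFinset
  obtain ⟨c, A, hc0, hc1, hA0, hblock⟩ := exists_block_contraction hfin.toFinset
    (a := σ₀ / 4) (e := 1 / (2 * Λ * D ^ 2)) (K := K + 1) (σ := σ₀) (ℓ := Λ) (D := D)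
    (by positivity) (by positivity) (by positivity) hσ₀ hΛ.le
    (fun v hv w hw => hPD v ((hmemV v).1 hv).1 w ((hmemV w).1 hw).1)
  rw [← Set.ncard_eq_toFinset_card _ hfin] at hblock
  -- The gradient error of iteration k is at most B times its sample error, which produces the
  -- factor B².
  refine ⟨c, A * B ^ 2, hc0, hc1, by positivity, fun carath M s x μ hM hrun => ?_⟩
  have hbatch : ∀ k, IsSmoothStronglyConvex (batchObjective f (s k)) (batchGradient f (s k)) σ₀
      (batchLipschitz L (s k)) := by
    intro k
    rw [batchObjective_eq, batchGradient_eq, batchLipschitz_eq]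
    exact IsSmoothStronglyConvex.weighted_sum (batchFreq_nonneg _) (sum_batchFreq (hM k) _) hfi
  have hbatchΛ : ∀ k, batchLipschitz L (s k) ≤ Λ := by
    intro k
    rw [batchLipschitz_eq]
    calc ∑ i, batchFreq (s k) i * L i ≤ ∑ i, batchFreq (s k) i * Λ :=
          Finset.sum_le_sum fun i _ => mul_le_mul_of_nonneg_left (hLΛ i) (batchFreq_nonneg _ _)
      _ = Λ := by rw [← Finset.sum_mul, sum_batchFreq (hM k), one_mul]
  have hprog := fun k (hk : 1 ≤ k) (hrep : IsRep C b (x k) (μ k)) =>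
    (hrun.step k hk).progress hrep (hbatch k) hσ₀ (hbatch k).le_lipschitz (hbatchΛ k) hPD
  have hrep : ∀ k, 1 ≤ k → IsRep C b (x k) (μ k) := by
    intro k hk
    induction k, hk using Nat.le_induction with
    | base =>
      rw [hrun.start_rep]
      exact isRep_single hrun.start_mem
    | succ k hk ih => exact (hprog k hk ih).1
  have hmem : ∀ k, 1 ≤ k → x k ∈ polytope C b := fun k hk => (hrep k hk).mem_polytope
  have hpair : ∀ k, 1 ≤ k → IsPairwiseStep hfin.toFinset (objectiveGradient f) (σ₀ / 4)
      (1 / (2 * Λ * D ^ 2)) (K + 1) σ₀ (x k) (x (k + 1)) (μ k).support (μ (k + 1)).support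
      (objective f (x k) - optValue f C b) (objective f (x (k + 1)) - optValue f C b)
      (B * sampleError (s k)) := by
    intro k hk
    obtain ⟨-, u, v, hv, hvmin, hu, humax, hquad, halt⟩ := hprog k hk (hrep k hk)
    have hgrad := norm_batchGradient_sub_le (fun i => hB i _ (hmem k hk)) (s k)
    refine ⟨batchGradient f (s k) (x k), u, v, _, ?_, hquad, hgrad, (hmemV v).2 hv,
      fun w hw => hvmin w ((hmemV w).1 hw).1, hu, ?_, ?_⟩
    · have h1 := objective_sub_le (x := x k) (y := x (k + 1)) (fun i => (hfi i).abs_sub_le hσ₀.le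
        (hB i _ (hmem k hk)) (hB i _ (hmem (k + 1) (by omega)))) (s k)
      linarith
    · set g := batchGradient f (s k) (x k)
      set δ := B * sampleError (s k)
      set r := ‖x k - xopt‖ with hr
      have hr0 : 0 ≤ r := norm_nonneg _
      have hgap : 0 ≤ inner ℝ g u - inner ℝ g v :=
        sub_nonneg.2 (hvmin u ((hrep k hk).support_subset u hu).1)
      have h1 := hF.lower (x k) xopt
      rw [hopt, ← neg_sub (x k) xopt, inner_neg_right, norm_neg, ← hr] at h1
      have h2 := hK _ _ (hrep k hk) xopt hxopt g u v humax fun w hw => hvmin w hw.1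
      rw [← hr] at h2
      have h3 := neg_le_of_abs_le (abs_real_inner_le_norm (g - objectiveGradient f (x k))
        (x k - xopt))
      rw [inner_sub_left, ← hr] at h3
      have h4 : ‖g - objectiveGradient f (x k)‖ * r ≤ δ * r := by gcongr
      set Γ := inner ℝ g u - inner ℝ g v
      have h5 : K * r * Γ ≤ (K + 1) * r * Γ := by
        gcongr
        linarith
      -- Completing the square in the unknown distance r to the optimum eliminates r. The constant
      -- is K + 1 because the block lemma needs a positive one.
      have h6 : objective f (x k) - optValue f C b ≤ ((K + 1) * Γ + δ) * r - σ₀ / 2 * r ^ 2 := by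
        linarith
      nlinarith [sq_nonneg ((K + 1) * Γ + δ - σ₀ * r)]
    · rcases halt with h | h
      · left
        rw [one_div_mul_eq_div]
        exact h
      · exact Or.inr h
  refine ⟨hmem, fun k hk => ?_⟩
  have := hblock (objectiveGradient f) (fun j => x (k + j)) (fun j => (μ (k + j)).support)
    (fun j => objective f (x (k + j)) - optValue f C b) (fun j => B * sampleError (s (k + j)))
    (fun j => sub_nonneg.2 (optValue_le hcompact hdiff (hmem _ (by omega))))
    (fun j => mul_nonneg hB0 (sampleError_nonneg _))
    (fun j v hv => (hmemV v).2 ((hrep (k + j) (by omega)).support_subset v hv))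
    (fun j => hF.lip _ _) (fun j => hpair (k + j) (by omega))
  simpa only [add_zero, mul_pow, ← Finset.mul_sum, mul_assoc] using this

end Run

/-! ### Mean square of the sampling error -/

section Sampling

open MeasureTheory ProbabilityTheory

variable {Ω : Type*} [MeasurableSpace Ω] {P : Measure Ω}

theorem integrable_comp_of_finite [IsFiniteMeasure P] {α : Type*} [Fintype α] [MeasurableSpace α]
    [MeasurableSingletonClass α] {X : Ω → α} (hX : Measurable X) (φ : α → ℝ) :
    Integrable (fun ω => φ (X ω)) P := by
  refine Integrable.of_bound ((measurable_of_finite φ).comp hX).aestronglyMeasurable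
    (∑ a, |φ a|) (Filter.Eventually.of_forall fun ω => ?_)
  rw [Real.norm_eq_abs]
  exact Finset.single_le_sum (f := fun a => |φ a|) (fun a _ => abs_nonneg _) (Finset.mem_univ _)

variable [IsProbabilityMeasure P] {n M : ℕ} {ξ : Fin M → Ω → Fin n}

/-- The frequency is a mean of M pairwise independent indicators with mean 1 / n, each of variance
at most 1. -/
theorem integral_batchFreq_sub_sq_le (hM : 0 < M) (hmeas : ∀ j, Measurable (ξ j))
    (hunif : ∀ j i, P {ω | ξ j ω = i} = (n : ENNReal)⁻¹)
    (hindep : Pairwise fun j j' => IndepFun (ξ j) (ξ j') P) (i : Fin n) :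
    ∫ ω, (batchFreq (fun j => ξ j ω) i - 1 / n) ^ 2 ∂P ≤ 1 / (M : ℝ) := by
  set φ : Fin n → ℝ := fun l => if l = i then 1 else 0 with hφ
  have hφm : Measurable φ := measurable_of_finite φ
  have hint : ∀ j, Integrable (fun ω => φ (ξ j ω)) P := fun j =>
    integrable_comp_of_finite (hmeas j) φ
  have hmem : ∀ j, MemLp (fun ω => φ (ξ j ω)) 2 P := fun j => by
    refine MemLp.of_bound (hφm.comp (hmeas j)).aestronglyMeasurable 1
      (Filter.Eventually.of_forall fun ω => ?_)
    simp only [hφ]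
    split <;> simp
  have hmean : ∀ j, ∫ ω, φ (ξ j ω) ∂P = 1 / n := by
    intro j
    have h1 : (fun ω => φ (ξ j ω)) = Set.indicator {ω | ξ j ω = i} 1 := by
      funext ω
      simp [hφ, Set.indicator_apply]
    have h2 : MeasurableSet {ω | ξ j ω = i} := hmeas j (measurableSet_singleton i)
    rw [h1, integral_indicator_one h2, Measure.real, hunif]
    simp
  have hvar : ∀ j, Var[fun ω => φ (ξ j ω); P] ≤ 1 := by
    intro j
    refine (variance_le_sq_of_bounded (a := 0) (b := 1)
      (Filter.Eventually.of_forall fun ω => ?_) (hφm.comp (hmeas j)).aemeasurable).trans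
      (by norm_num)
    simp only [hφ, Function.comp_apply]
    split <;> simp
  have hsum : Var[∑ j, fun ω => φ (ξ j ω); P] ≤ M := by
    rw [IndepFun.variance_sum (fun j _ => hmem j)
      fun j _ j' _ hjj' => (hindep hjj').comp hφm hφm]
    calc ∑ j, Var[fun ω => φ (ξ j ω); P] ≤ ∑ _j : Fin M, (1 : ℝ) :=
          Finset.sum_le_sum fun j _ => hvar j
      _ = M := by simp
  have hM' : (0 : ℝ) < M := by exact_mod_cast hM
  have hfreq : (fun ω => batchFreq (fun j => ξ j ω) i) =
      fun ω => (1 / (M : ℝ)) * (∑ j, fun ω => φ (ξ j ω)) ω := by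
    funext ω
    simp only [batchFreq, Finset.sum_apply, hφ]
  have hfreqmean : ∫ ω, batchFreq (fun j => ξ j ω) i ∂P = 1 / n := by
    simp only [hfreq, Finset.sum_apply]
    rw [integral_const_mul, integral_finsetSum _ fun j _ => hint j]
    simp only [hmean, Finset.sum_const, Finset.card_univ, Fintype.card_fin, nsmul_eq_mul]
    field_simp
  have hfreqm : Measurable fun ω => batchFreq (fun j => ξ j ω) i :=
    (measurable_of_finite fun s : Fin M → Fin n => batchFreq s i).comp
      (measurable_pi_lambda _ hmeas)
  calc ∫ ω, (batchFreq (fun j => ξ j ω) i - 1 / n) ^ 2 ∂P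
      = Var[fun ω => batchFreq (fun j => ξ j ω) i; P] := by
        rw [variance_eq_integral hfreqm.aemeasurable, hfreqmean]
    _ = (1 / (M : ℝ)) ^ 2 * Var[∑ j, fun ω => φ (ξ j ω); P] := by
        rw [hfreq, variance_const_mul]
    _ ≤ (1 / (M : ℝ)) ^ 2 * M := by gcongr
    _ = 1 / M := by field_simp

theorem integrable_sampleError_sq (hmeas : ∀ j, Measurable (ξ j)) :
    Integrable (fun ω => sampleError (fun j => ξ j ω) ^ 2) P :=
  integrable_comp_of_finite (measurable_pi_lambda _ hmeas) fun s => sampleError s ^ 2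

theorem integral_sampleError_sq_le (hM : 0 < M) (hmeas : ∀ j, Measurable (ξ j))
    (hunif : ∀ j i, P {ω | ξ j ω = i} = (n : ENNReal)⁻¹)
    (hindep : Pairwise fun j j' => IndepFun (ξ j) (ξ j') P) :
    ∫ ω, sampleError (fun j => ξ j ω) ^ 2 ∂P ≤ (n : ℝ) ^ 2 / M := by
  have hint : ∀ i, Integrable (fun ω => (batchFreq (fun j => ξ j ω) i - 1 / n) ^ 2) P := fun i =>
    integrable_comp_of_finite (measurable_pi_lambda _ hmeas)
      fun s : Fin M → Fin n => (batchFreq s i - 1 / n) ^ 2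
  calc ∫ ω, sampleError (fun j => ξ j ω) ^ 2 ∂P
      ≤ ∫ ω, (n : ℝ) * ∑ i, (batchFreq (fun j => ξ j ω) i - 1 / n) ^ 2 ∂P := by
        -- Cauchy–Schwarz passes from the squared ℓ¹-norm to a sum of variances, at the cost of a
        -- factor n.
        refine integral_mono (integrable_sampleError_sq hmeas)
          ((integrable_finsetSum _ fun i _ => hint i).const_mul _) fun ω => ?_
        have := sq_sum_le_card_mul_sum_sq (s := (Finset.univ : Finset (Fin n)))
          (f := fun i => |batchFreq (fun j => ξ j ω) i - 1 / n|)
        simpa [sampleError] using this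
    _ = (n : ℝ) * ∑ i, ∫ ω, (batchFreq (fun j => ξ j ω) i - 1 / n) ^ 2 ∂P := by
        rw [integral_const_mul, integral_finsetSum _ fun i _ => hint i]
    _ ≤ (n : ℝ) * ∑ _i : Fin n, 1 / (M : ℝ) := by
        gcongr with i
        exact integral_batchFreq_sub_sq_le hM hmeas hunif hindep i
    _ = (n : ℝ) ^ 2 / M := by
        rw [Finset.sum_const, Finset.card_univ, Fintype.card_fin, nsmul_eq_mul]
        ring

end Sampling

/-! ### Batch sizes and geometric decay -/

theorem batchSize_pos {κ : ℝ} (hκ : κ < 1) (k : ℕ) : 0 < batchSize κ k := by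
  have : 0 < 1 - κ := by linarith
  exact Nat.ceil_pos.2 (by positivity)

theorem inv_batchSize_le {κ : ℝ} (hκ : κ < 1) (k : ℕ) :
    1 / (batchSize κ k : ℝ) ≤ (1 - κ) ^ (2 * k + 2) := by
  have h : 0 < 1 - κ := by linarith
  rw [div_le_iff₀ (by exact_mod_cast batchSize_pos hκ k)]
  have h1 := Nat.le_ceil (1 / (1 - κ) ^ (2 * k + 2))
  rwa [div_le_iff₀' (by positivity)] at h1

/-- A block contraction with a geometrically decaying perturbation gives geometric decay. -/
theorem exists_geometric_rate {c A q H : ℝ} {T : ℕ} (hc0 : 0 < c) (hA : 0 ≤ A)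
    (hc1 : c < 1) (hq0 : 0 ≤ q) (hq1 : q < 1) (hH : 0 ≤ H) (hT : 0 < T) :
    ∃ B ρ : ℝ, 0 ≤ B ∧ 0 < ρ ∧ ρ < 1 ∧ ∀ e : ℕ → ℝ, (∀ k, 1 ≤ k → e k ≤ H) →
      (∀ k, 1 ≤ k → e (k + T) ≤ (1 - c) * e k + A * q ^ k) →
      ∀ k, 1 ≤ k → e k ≤ B * ρ ^ k := by
  have hev : ∀ᶠ ρ : ℝ in nhdsWithin 1 (Set.Iio 1), 1 - c / 2 < ρ ^ T ∧ q < ρ ∧ ρ < 1 := by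
    refine Filter.Eventually.and ?_ (Filter.Eventually.and ?_ self_mem_nhdsWithin)
    · have h1 := (continuous_pow T).tendsto (1 : ℝ)
      rw [one_pow] at h1
      exact (h1.eventually (lt_mem_nhds (by linarith))).filter_mono nhdsWithin_le_nhds
    · exact (lt_mem_nhds hq1).filter_mono nhdsWithin_le_nhds
  obtain ⟨ρ, hρT, hqρ, hρ1⟩ := hev.exists
  have hρ0 : 0 < ρ := hq0.trans_lt hqρ
  -- The summand H / ρ^T covers the indices up to T. The summand 2A / c gives A ≤ (c / 2) B, so half
  -- of the contraction absorbs the perturbation and ρ^T > 1 - c / 2 closes the induction.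
  refine ⟨2 * A / c + H / ρ ^ T, ρ, by positivity, hρ0, hρ1, fun e he hrec => ?_⟩
  set B := 2 * A / c + H / ρ ^ T with hB
  have hB0 : 0 ≤ B := by positivity
  intro k
  induction k using Nat.strong_induction_on with
  | _ k ih =>
    intro hk
    rcases le_or_gt k T with hkT | hkT
    · calc e k ≤ H := he k hk
        _ = H / ρ ^ T * ρ ^ T := by field_simp
        _ ≤ B * ρ ^ T := by
            gcongr
            rw [hB]
            linarith [show 0 ≤ 2 * A / c by positivity]
        _ ≤ B * ρ ^ k := by
            exact mul_le_mul_of_nonneg_left (pow_le_pow_of_le_one hρ0.le hρ1.le hkT) hB0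
    · obtain ⟨l, rfl⟩ := Nat.exists_eq_add_of_le' hkT.le
      have hl : 1 ≤ l := by omega
      have h1 := ih l (by omega) hl
      have h2 : q ^ l ≤ ρ ^ l := by gcongr
      have h3 : A ≤ c / 2 * B := by
        have : c / 2 * (2 * A / c) = A := by field_simp
        rw [hB, mul_add, this]
        linarith [show 0 ≤ c / 2 * (H / ρ ^ T) by positivity]
      have hρl : 0 < ρ ^ l := by positivity
      calc e (l + T) ≤ (1 - c) * e l + A * q ^ l := hrec l hl
        _ ≤ (1 - c) * (B * ρ ^ l) + c / 2 * B * ρ ^ l := by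
            gcongr
        _ = (1 - c / 2) * (B * ρ ^ l) := by ring
        _ ≤ ρ ^ T * (B * ρ ^ l) := by gcongr
        _ = B * ρ ^ (l + T) := by rw [pow_add]; ring

theorem pow_le_rpow_of_le_one_sub {ρ φ W : ℝ} (hρ : 0 < ρ) (hφ : 0 ≤ φ) (hρφ : ρ ≤ 1 - φ)
    (hW : 1 ≤ W) (k : ℕ) : ρ ^ k ≤ (1 - φ) ^ ((k : ℝ) / W) := by
  have h0 : 0 < 1 - φ := hρ.trans_le hρφ
  calc ρ ^ k ≤ (1 - φ) ^ k := by gcongr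
    _ = (1 - φ) ^ (k : ℝ) := (Real.rpow_natCast _ _).symm
    _ ≤ (1 - φ) ^ ((k : ℝ) / W) :=
        Real.rpow_le_rpow_of_exponent_ge h0 (by linarith)
          (div_le_self (Nat.cast_nonneg k) hW)

end PSFW

/-! ### The convergence theorem -/

theorem theorem2 {n p m : ℕ} (hn : 0 < n)
    (C : Fin m → PSFW.E p) (b : Fin m → ℝ)
    (hcompact : IsCompact (PSFW.polytope C b)) (hnontrivial : (PSFW.polytope C b).Nontrivial)
    (f : Fin n → PSFW.E p → ℝ) (σ : Fin n → ℝ) (L : Fin n → NNReal)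
    (hσ : ∀ i, 0 < σ i)
    (hconvex : ∀ i, StrongConvexOn Set.univ (σ i) (f i))
    (hdiff : ∀ i, Differentiable ℝ (f i))
    (hlip : ∀ i, LipschitzWith (L i) (gradient (f i)))
    (carath : Bool) :
    ∃ C₃ φ : ℝ, 0 < φ ∧ φ < PSFW.kappa C b σ L carath ∧
      ∀ {Ω : Type*} [MeasurableSpace Ω] (P : MeasureTheory.Measure Ω)
        [MeasureTheory.IsProbabilityMeasure P]
        (ξ : (k : ℕ) → Fin (PSFW.batchSize (PSFW.kappa C b σ L carath) k) → Ω → Fin n)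
        (x : ℕ → Ω → PSFW.E p) (μ : ℕ → Ω → PSFW.E p →₀ ℝ),
        PSFW.IsIIDUniform P ξ →
        (∀ k, 1 ≤ k → Measurable (x k)) →
        (∀ ω, PSFW.IsRun C b f L carath (fun k j => ξ k j ω) (fun k => x k ω)
          (fun k => μ k ω)) →
        ∀ k : ℕ, 1 ≤ k →
          MeasureTheory.Integrable
            (fun ω => PSFW.objective f (x (k + 1) ω) - PSFW.optValue f C b) P ∧
          ∫ ω, (PSFW.objective f (x (k + 1) ω) - PSFW.optValue f C b) ∂P ≤
            C₃ * (1 - φ) ^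
              ((k : ℝ) / (3 * (Nat.factorial (PSFW.vertices C b).ncard : ℝ) + 1)) := by
  have : Nontrivial (PSFW.E p) := by
    obtain ⟨y, -, z, -, h⟩ := hnontrivial
    exact ⟨y, z, h⟩
  have hL : ∀ i, 0 < L i := fun i => NNReal.coe_pos.1 ((hσ i).trans_le
    (PSFW.isSmoothStronglyConvex_gradient (hconvex i) (hdiff i) (hlip i)).le_lipschitz)
  set κ := PSFW.kappa C b σ L carath
  have hκ0 : 0 < κ := PSFW.kappa_pos hn hcompact hnontrivial hσ hL carath
  have hκ2 : κ ≤ 1 / 2 := PSFW.kappa_le_half C b σ L carath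
  have hκ1 : κ < 1 := by linarith
  obtain ⟨c, A, hc0, hc1, hA, hrun⟩ :=
    PSFW.exists_run_contraction hn hcompact hnontrivial hσ hconvex hdiff hlip
  set T := (PSFW.vertices C b).ncard + 1 with hT
  obtain ⟨H, hH⟩ := hcompact.exists_bound_of_continuousOn
    (f := fun y => PSFW.objective f y - PSFW.optValue f C b)
    ((PSFW.continuous_objective hdiff).sub continuous_const).continuousOn
  have hH0 : 0 ≤ H := by
    obtain ⟨y, hy⟩ := hnontrivial.nonempty
    exact (norm_nonneg _).trans (hH y hy)
  -- A block has T error terms, each with mean at most n² (1 - κ)^(2k). All constants are fixed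
  -- before the probability space appears.
  obtain ⟨B, ρ, hB, hρ0, hρ1, hrate⟩ := PSFW.exists_geometric_rate (A := A * (T * n ^ 2))
    (q := (1 - κ) ^ 2) (T := T) hc0 (by positivity) hc1 (by positivity)
    (by nlinarith) hH0 (Nat.succ_pos _)
  -- κ / 2 makes φ strictly smaller than κ, and 1 - ρ makes ρ ≤ 1 - φ.
  refine ⟨B, min (κ / 2) (1 - ρ), lt_min (by linarith) (by linarith),
    (min_le_left _ _).trans_lt (by linarith), ?_⟩
  intro Ω _ P _ ξ x μ hξ hx hωrun k hk
  have hM : ∀ k, 0 < PSFW.batchSize κ k := PSFW.batchSize_pos hκ1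
  have hpath := fun ω => hrun carath _ _ _ _ hM (hωrun ω)
  have hint : ∀ k, 1 ≤ k → MeasureTheory.Integrable
      (fun ω => PSFW.objective f (x k ω) - PSFW.optValue f C b) P := by
    intro k hk
    refine MeasureTheory.Integrable.of_bound ?_ H
      (Filter.Eventually.of_forall fun ω => hH _ ((hpath ω).1 k hk))
    exact (((PSFW.continuous_objective hdiff).measurable.comp
      (hx k hk)).sub_const _).aestronglyMeasurable
  have herr : ∀ k, 1 ≤ k →
      ∫ ω, PSFW.sampleError (fun j => ξ k j ω) ^ 2 ∂P ≤ n ^ 2 * ((1 - κ) ^ 2) ^ k := by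
    intro k hk
    -- The independence hypothesis indexes iteration k + 1 by k.
    obtain ⟨k, rfl⟩ := Nat.exists_eq_add_of_le' hk
    refine (PSFW.integral_sampleError_sq_le (hM _) (hξ.measurable _ hk)
      (hξ.uniform _ hk) ?_).trans ?_
    · intro j j' hjj'
      exact hξ.indep.indepFun (i := ⟨k, j⟩) (j := ⟨k, j'⟩) fun h => hjj' (by simpa using h)
    · rw [div_eq_mul_one_div]
      gcongr
      refine (PSFW.inv_batchSize_le hκ1 _).trans ?_
      rw [← pow_mul]
      exact pow_le_pow_of_le_one (by linarith) (by linarith) (by omega)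
  have hgeo := hrate (fun k => ∫ ω, (PSFW.objective f (x k ω) - PSFW.optValue f C b) ∂P)
    ?_ ?_ (k + 1) (by omega)
  · refine ⟨hint _ (by omega), hgeo.trans ?_⟩
    gcongr
    refine (pow_le_pow_of_le_one hρ0.le hρ1.le (Nat.le_succ k)).trans ?_
    refine PSFW.pow_le_rpow_of_le_one_sub hρ0 (le_min (by linarith) (by linarith)) ?_ ?_ k
    · linarith [min_le_right (κ / 2) (1 - ρ)]
    · have : (0 : ℝ) ≤ (PSFW.vertices C b).ncard.factorial := Nat.cast_nonneg _
      linarith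
  · intro k hk
    calc ∫ ω, (PSFW.objective f (x k ω) - PSFW.optValue f C b) ∂P ≤ ∫ _, H ∂P :=
          MeasureTheory.integral_mono (hint k hk) (MeasureTheory.integrable_const _)
            fun ω => (le_abs_self _).trans (hH _ ((hpath ω).1 k hk))
      _ = H := by simp
  · intro k hk
    have herrint : ∀ j, MeasureTheory.Integrable
        (fun ω => PSFW.sampleError (fun i => ξ (k + j) i ω) ^ 2) P :=
      fun j => PSFW.integrable_sampleError_sq (hξ.measurable _ (by omega))
    have hsumint := MeasureTheory.integrable_finsetSum (Finset.range T) fun j _ => herrint j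
    calc ∫ ω, (PSFW.objective f (x (k + T) ω) - PSFW.optValue f C b) ∂P
        ≤ ∫ ω, ((1 - c) * (PSFW.objective f (x k ω) - PSFW.optValue f C b) +
            A * ∑ j ∈ Finset.range T, PSFW.sampleError (fun i => ξ (k + j) i ω) ^ 2) ∂P :=
          MeasureTheory.integral_mono (hint _ (by omega))
            (((hint k hk).const_mul _).add (hsumint.const_mul _))
            fun ω => (hpath ω).2 k hk
      _ = (1 - c) * ∫ ω, (PSFW.objective f (x k ω) - PSFW.optValue f C b) ∂P +
            A * ∑ j ∈ Finset.range T, ∫ ω, PSFW.sampleError (fun i => ξ (k + j) i ω) ^ 2 ∂P := by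
          rw [MeasureTheory.integral_add ((hint k hk).const_mul _) (hsumint.const_mul _),
            MeasureTheory.integral_const_mul, MeasureTheory.integral_const_mul,
            MeasureTheory.integral_finsetSum _ fun j _ => herrint j]
      _ ≤ (1 - c) * ∫ ω, (PSFW.objective f (x k ω) - PSFW.optValue f C b) ∂P +
            A * ∑ _j ∈ Finset.range T, n ^ 2 * ((1 - κ) ^ 2) ^ k := by
          gcongr with j
          refine (herr (k + j) (by omega)).trans ?_
          gcongr ?_ * ?_
          exact pow_le_pow_of_le_one (by positivity) (by nlinarith) (by omega)
      _ = _ := by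
          rw [Finset.sum_const, Finset.card_range, nsmul_eq_mul]
          ring
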